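/- Let $\Sigma$ be a smooth compact embedded $(n-1)$-dimensional submanifold (without boundary) of the unit sphere $\mathbb S^{2n-1}\subset\mathbb C^n$, and let $C=\{r\sigma : \sigma\in\Sigma,\ r\in(0,\infty)\}$ be the cone over $\Sigma$ with the origin removed, with the metric induced from $\mathbb C^n\cong\mathbb R^{2n}$. Suppose that $C$ is special Lagrangian: for some real $\theta$, $C$ is an oriented embedded $n$-dimensional submanifold of $\mathbb C^n$ such that $\mathrm{Re}(e^{-i\theta}\,dz_1\wedge\cdots\wedge dz_n)$ takes the value $1$ on every oriented orthonormal basis of every tangent space of $C$. A smooth 1-form $\alpha$ on $C$ is said to have homogeneity $\lambda\in\mathbb R$ if $$\alpha=r^{\lambda}\,\eta\,dr+r^{\lambda+1}\,\omega,\qquad r=|x|,$$ where $\eta$ is a function on $\Sigma$ and $\omega$ is a 1-form on $\Sigma$, both pulled back to $C$ by $x\mapsto x/|x|$. It is closed if $d\alpha=0$, and co-closed if $\delta\alpha=0$, where $\delta$ is the codifferential of the induced metric on $C$. 1. If $n=4$ and $\Sigma$ is simply connected (in particular connected), then every closed and co-closed smooth 1-form on $C$ of homogeneity $\lambda=-1$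 vanishes identically. 2. If $n>4$, then every closed and co-closed smooth 1-form on $C$ of homogeneity $\lambda=(2-n)/2$ vanishes identically. -/

import Mathlib

open scoped ContDiff

noncomputable section

section Submanifolds

variable {E : Type*} [NormedAddCommGroup E] [InnerProductSpace ℝ E]

/-- `M` is a smooth embedded `d`-dimensional submanifold (without boundary) of `E`: around each
of its points there is a smooth diffeomorphism `Φ` between open subsets of `E` that carries `M`
to a `d`-dimensional linear subspace. -/
def IsEmbeddedSubmanifold (d : ℕ) (M : Set E) : Prop :=
  ∀ x ∈ M, ∃ (Φ : OpenPartialHomeomorph E E) (W : Submodule ℝ E),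
    x ∈ Φ.source ∧ ContDiffOn ℝ ∞ Φ Φ.source ∧ ContDiffOn ℝ ∞ Φ.symm Φ.target ∧
    Module.finrank ℝ W = d ∧ ∀ y ∈ Φ.source, y ∈ M ↔ Φ y ∈ W

/-- The tangent space of `M` at `x`: the velocities at `x` of the differentiable curves in `M`.
(On an embedded submanifold these velocities form a linear subspace already, so that taking the
span adds nothing; it only makes the definition a subspace by construction.) -/
def tangentSpaceAt (M : Set E) (x : E) : Submodule ℝ E :=
  Submodule.span ℝ {v | ∃ γ : ℝ → E, γ 0 = x ∧ (∀ᶠ t in nhds 0, γ t ∈ M) ∧ HasDerivAt γ v 0}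

/-- The cone over `S` with vertex at the origin, the vertex removed. -/
def coneOver (S : Set E) : Set E := {x | ∃ r : ℝ, 0 < r ∧ ∃ σ ∈ S, x = r • σ}

/-- An orientation of the `d`-dimensional submanifold `M`: an orientation of every tangent space
that is locally represented by a continuous frame. -/
structure SubmanifoldOrientation (d : ℕ) (M : Set E) where
  /-- the orientation of the tangent space at each point -/
  at_point : ∀ x : M, Orientation ℝ (tangentSpaceAt M (x : E)) (Fin d)
  continuous_at_point : ∀ x : M, ∃ U ∈ nhds x, ∃ e : ∀ y : M,
    Module.Basis (Fin d) ℝ (tangentSpaceAt M (y : E)),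
      (∀ i, ContinuousOn (fun y : M => (e y i : E)) U) ∧
      ∀ y ∈ U, (e y).orientation = at_point y

/-- `M`, with the orientation `o`, is calibrated by the (constant coefficient) `d`-form `φ`: it
takes the value `1` on every oriented orthonormal basis of every tangent space. -/
def IsCalibratedBy {d : ℕ} {M : Set E} (o : SubmanifoldOrientation d M)
    (φ : E [⋀^Fin d]→ₗ[ℝ] ℝ) : Prop :=
  ∀ (x : M) (b : OrthonormalBasis (Fin d) ℝ (tangentSpaceAt M (x : E))),
    b.toBasis.orientation = o.at_point x → φ (fun i => (b i : E)) = 1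

end Submanifolds

section OneForms

variable {E : Type*} [NormedAddCommGroup E] [InnerProductSpace ℝ E]

/-- A (not necessarily continuous) 1-form on `M`: a linear form on each tangent space. -/
abbrev OneForm (M : Set E) : Type _ := ∀ x : M, tangentSpaceAt M (x : E) →L[ℝ] ℝ

namespace OneForm

variable [FiniteDimensional ℝ E] {M : Set E}

open Classical in
/-- The 1-form `α` on `M` as a map into the fixed space of covectors of `E`: at points of `M`, it
is `α` on tangent vectors and `0` on normal vectors. Off `M` the value is irrelevant. -/
def extend (α : OneForm M) (x : E) : E →L[ℝ] ℝ :=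
  if hx : x ∈ M then (α ⟨x, hx⟩).comp (tangentSpaceAt M x).orthogonalProjectionOnto else 0

/-- Smoothness of a 1-form on an embedded submanifold. -/
def IsSmooth (α : OneForm M) : Prop := ContDiffOn ℝ ∞ α.extend M

/-- The exterior derivative `dα` at `x ∈ M`, a 2-form on the tangent space: the exterior
derivative of `α`, as a covector valued map on `M`, restricted to tangent vectors. Only the
derivatives of that map in directions tangent to `M` enter, and these are determined by its values
on `M`. -/
def extDerivAt (α : OneForm M) (x : M) : tangentSpaceAt M (x : E) [⋀^Fin 2]→L[ℝ] ℝ :=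
  (extDerivWithin (fun y => ContinuousAlternatingMap.ofSubsingleton ℝ E ℝ (0 : Fin 1)
    (α.extend y)) M (x : E)).compContinuousLinearMap (tangentSpaceAt M (x : E)).subtypeL

/-- The tangent vector field on `M` that is dual to `α` with respect to the induced metric. -/
def sharp (α : OneForm M) (x : E) : E := (InnerProductSpace.toDual ℝ E).symm (α.extend x)

/-- The codifferential `δα = - div (α♯)`. The divergence at `x` is the trace of the covariant
derivative `v ↦ ∇_v α♯` on the tangent space, and the Levi-Civita connection of the
induced metric is the tangential part of the derivative in `E`. -/
def codifferential (α : OneForm M) (x : M) : ℝ :=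
  - LinearMap.trace ℝ (tangentSpaceAt M (x : E))
      (((tangentSpaceAt M (x : E)).orthogonalProjectionOnto.comp
        ((fderivWithin ℝ α.sharp M (x : E)).comp (tangentSpaceAt M (x : E)).subtypeL)) :
          tangentSpaceAt M (x : E) →ₗ[ℝ] tangentSpaceAt M (x : E))

/-- `dα = 0`. -/
def IsClosed (α : OneForm M) : Prop := ∀ x : M, α.extDerivAt x = 0

/-- `δα = 0`. -/
def IsCoclosed (α : OneForm M) : Prop := ∀ x : M, α.codifferential x = 0

/-- The 1-form `α` on the cone over `S` is homogeneous of homogeneity `lam`: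
`α = r ^ lam η dr + r ^ (lam + 1) β` for a function `η` and a 1-form `β` on the link `S`, where
`r = ‖x‖` and where `η` and `β` are pulled back to the cone by `x ↦ ‖x‖⁻¹ x`. -/
def IsHomogeneous {S : Set E} (α : OneForm (coneOver S)) (lam : ℝ) : Prop :=
  ∃ (η : S → ℝ) (β : OneForm S), ∀ (σ : S) (r : ℝ) (hr : 0 < r)
    (v : tangentSpaceAt (coneOver S) (r • (σ : E))),
      α ⟨r • (σ : E), r, hr, σ, σ.2, rfl⟩ v =
        r ^ lam * η σ * fderiv ℝ (fun y : E => ‖y‖) (r • (σ : E)) v +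
        r ^ (lam + 1) *
          β.extend σ (fderiv ℝ (fun y : E => ‖y‖⁻¹ • y) (r • (σ : E)) v)

end OneForm

end OneForms

section SpecialLagrangian

/-- The holomorphic volume form `Ω = dz₁ ∧ ⋯ ∧ dzₙ` on `ℂⁿ`. -/
def holomorphicVolumeForm (n : ℕ) : EuclideanSpace ℂ (Fin n) [⋀^Fin n]→ₗ[ℂ] ℂ :=
  (Matrix.detRowAlternating (n := Fin n) (R := ℂ)).compLinearMap
    (WithLp.linearEquiv 2 ℂ (Fin n → ℂ)).toLinearMap

/-- The real `n`-form `Re (e^{-iθ} Ω)` on `ℂⁿ`. -/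
def specialLagrangianForm (n : ℕ) (θ : ℝ) : EuclideanSpace ℂ (Fin n) [⋀^Fin n]→ₗ[ℝ] ℝ :=
  { Complex.reLm.compMultilinearMap (Complex.exp (-(Complex.I * θ)) •
      (holomorphicVolumeForm n).toMultilinearMap.restrictScalars ℝ) with
    map_eq_zero_of_eq' := by
      intro v i j hv hij
      have h := (holomorphicVolumeForm n).map_eq_zero_of_eq v hv hij
      simp [h] }

/-- `M` is a special Lagrangian submanifold of `ℂⁿ` with angle `e^{iθ}`: an oriented embedded
`n`-dimensional submanifold calibrated by `Re (e^{-iθ} Ω)`. -/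
def IsSpecialLagrangian {n : ℕ} (θ : ℝ) (M : Set (EuclideanSpace ℂ (Fin n))) : Prop :=
  IsEmbeddedSubmanifold n M ∧
    ∃ o : SubmanifoldOrientation n M, IsCalibratedBy o (specialLagrangianForm n θ)

end SpecialLagrangian

end

/-!
The argument takes place on the cone `C` itself, viewed as an `n`-dimensional submanifold of the
ambient space, and works with the vector field `V` dual to `α`. It is tangent to `C`, its
derivative is symmetric on the tangent spaces (`α` is closed), its divergence along `C` vanishes
(`α` is co-closed), and `V (t x) = t ^ lam V x`. By Cartan's formula `F x = ⟪V x, x⟫` has gradient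
`(lam + 1) V` (`IsHarmonicField.hasTangentGradAt_inner_self`). Both parts of the theorem follow
from maximum principles for harmonic functions on `C`.

If `n > 4` and `lam = (2 - n) / 2`, then `F` is harmonic and homogeneous of degree
`p = lam + 1 = (4 - n) / 2`, which lies strictly between `2 - n` and `0`. If `F` had a positive
maximum `m` on the link, the function `F - m r ^ p` would be maximal there along all of `C`,
although its Laplacian is `-m p (n + p - 2) r ^ (p - 2) > 0`. The same applies to `-F`, so that `F`
and its gradient vanish (`IsHarmonicField.eq_zero_of_exponent`).

If `n = 4` and `lam = -1`, then `F` is a constant `e`. The Poincaré lemma provides local primitives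
of `V`. Restricted to the link, they are glued by means of a section of a covering space
(`exists_glue_of_sub_locallyConstant`), and yield a function `G` of homogeneity `0` with gradient
`V - e x / r ^ 2` (`IsHarmonicField.exists_primitive`). The divergence of this field is
`-e (n - 2) / r ^ 2`. Comparing its sign at a maximum and at a minimum of `G` gives `e = 0`; so
`G` is harmonic, and it is constant by Hopf's strong maximum principle, which is proved in a
Euclidean ball (`eq_of_isMaxOn_ball_of_elliptic`) and transported to submanifolds by local
parametrizations (`eventually_eq_of_isMaxOn_of_tangentialDivergence_eq_zero`).
-/

/-! ### Maximum principles in a Euclidean ball -/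

section MaximumPrinciple

open Set Filter Topology Metric

/-- The second derivative test at a maximum. -/
theorem IsLocalMax.second_deriv_nonpos {g g' : ℝ → ℝ} {c t₀ : ℝ}
    (hmax : IsLocalMax g t₀) (hg : ∀ᶠ t in 𝓝 t₀, HasDerivAt g (g' t) t)
    (hg' : HasDerivAt g' c t₀) : c ≤ 0 := by
  by_contra! hc
  have hderiv : deriv g =ᶠ[𝓝 t₀] g' := hg.mono fun t ht => ht.deriv
  have h2 : deriv (deriv g) t₀ = c := by rw [hderiv.deriv_eq, hg'.deriv]
  have hmin : IsLocalMin g t₀ := isLocalMin_of_deriv_deriv_pos (by rw [h2]; exact hc)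
    hmax.deriv_eq_zero hg.self_of_nhds.continuousAt
  -- a point that is both a local maximum and a local minimum has a neighbourhood where `g`
  -- is constant
  have hconst : g =ᶠ[𝓝 t₀] fun _ => g t₀ := by
    filter_upwards [hmax, hmin] with t h1 h2 using le_antisymm h1 h2
  have h3 : deriv g =ᶠ[𝓝 t₀] fun _ => (0 : ℝ) := by
    simpa using hconst.deriv
  rw [h3.deriv_eq] at h2
  simp at h2
  exact hc.ne h2

variable {W : Type*} [NormedAddCommGroup W] [InnerProductSpace ℝ W]

/-- The inner product of a real inner product space as a bilinear (rather than sesquilinear)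
continuous map. -/
noncomputable def realInnerL : W →L[ℝ] W →L[ℝ] ℝ := innerSL ℝ

@[simp]
theorem realInnerL_apply (v w : W) : realInnerL v w = inner ℝ v w := rfl

theorem IsLocalMax.second_fderiv_nonpos {u : W → ℝ} {u' : W → W →L[ℝ] ℝ}
    {u'' : W →L[ℝ] W →L[ℝ] ℝ} {w : W} (hmax : IsLocalMax u w)
    (hu : ∀ᶠ y in 𝓝 w, HasFDerivAt u (u' y) y) (hu' : HasFDerivAt u' u'' w) (a : W) :
    u'' a a ≤ 0 := by
  have hline : ∀ t : ℝ, HasDerivAt (fun t : ℝ => w + t • a) a t := fun t => by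
    simpa using ((hasDerivAt_id t).smul_const a).const_add w
  have h0 : (fun t : ℝ => w + t • a) 0 = w := by simp
  have htend : Tendsto (fun t : ℝ => w + t • a) (𝓝 0) (𝓝 w) := by
    simpa using (hline 0).continuousAt.tendsto
  refine IsLocalMax.second_deriv_nonpos (g := fun t : ℝ => u (w + t • a))
    (g' := fun t : ℝ => u' (w + t • a) a) (t₀ := 0) ?_ ?_ ?_
  · have := htend.eventually hmax
    simpa [IsLocalMax, IsMaxFilter] using this
  · filter_upwards [htend.eventually hu] with t ht
    exact ht.comp_hasDerivAt t (hline t)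
  · have h1 : HasFDerivAt u' u'' ((fun t : ℝ => w + t • a) 0) := by rwa [h0]
    have h2 := h1.comp_hasDerivAt 0 (hline 0)
    simpa using (h2.clm_apply (hasDerivAt_const (0 : ℝ) a))

theorem IsCompact.exists_lt_forall_le {X : Type*} [TopologicalSpace X] {A : Set X} {u : X → ℝ}
    (hA : IsCompact A) (hu : ContinuousOn u A) {m : ℝ} (hlt : ∀ y ∈ A, u y < m) :
    ∃ δ > 0, ∀ y ∈ A, u y ≤ m - δ := by
  rcases A.eq_empty_or_nonempty with rfl | hne
  · exact ⟨1, one_pos, by simp⟩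
  · obtain ⟨y, hy, hmax⟩ := hA.exists_isMaxOn hne hu
    exact ⟨m - u y, by linarith [hlt y hy], fun z hz => by linarith [isMaxOn_iff.1 hmax z hz]⟩

/-- The Gaussian `exp (-k ‖w - p‖²)`, the barrier in Hopf's argument. -/
noncomputable def gaussianBarrier (k : ℝ) (p w : W) : ℝ := Real.exp (-k * ‖w - p‖ ^ 2)

theorem hasFDerivAt_gaussianBarrier (k : ℝ) (p w : W) :
    HasFDerivAt (gaussianBarrier k p)
      ((-2 * k * gaussianBarrier k p w) • realInnerL (w - p)) w := by
  have h1 : HasFDerivAt (fun w : W => ‖w - p‖ ^ 2) (2 • realInnerL (w - p)) w :=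
    ((hasFDerivAt_id w).sub_const p).norm_sq
  have h2 := (h1.const_mul (-k)).exp
  refine h2.congr_fderiv ?_
  ext v
  simp [gaussianBarrier]
  ring

theorem hasFDerivAt_fderiv_gaussianBarrier (k : ℝ) (p w : W) :
    HasFDerivAt (fun w => (-2 * k * gaussianBarrier k p w) • realInnerL (w - p))
      ((-2 * k * gaussianBarrier k p w) • realInnerL +
        ((-2 * k) • ((-2 * k * gaussianBarrier k p w) • realInnerL (w - p))).smulRight
          (realInnerL (w - p))) w := by
  have h1 : HasFDerivAt (fun w : W => realInnerL (w - p)) realInnerL w :=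
    realInnerL.hasFDerivAt.comp w ((hasFDerivAt_id w).sub_const p)
  exact ((hasFDerivAt_gaussianBarrier k p w).const_mul (-2 * k)).smul h1

variable [FiniteDimensional ℝ W]

/-- The strong maximum principle of Hopf on a ball, for a function that solves a second order
equation `∑ i, D²u (a i, a i) = Du b` whose coefficients are bounded and uniformly elliptic (but
need not be continuous). -/
theorem eq_of_isMaxOn_ball_of_elliptic {ι : Type*} [Fintype ι] {w₀ : W} {r K c : ℝ} (hc : 0 < c)
    {u : W → ℝ} {u' : W → W →L[ℝ] ℝ} {u'' : W → W →L[ℝ] W →L[ℝ] ℝ}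
    (hu : ∀ w ∈ ball w₀ r, HasFDerivAt u (u' w) w)
    (hu' : ∀ w ∈ ball w₀ r, HasFDerivAt u' (u'' w) w)
    (hell : ∀ w ∈ ball w₀ r, ∃ (a : ι → W) (b : W), (∀ i, ‖a i‖ ≤ K) ∧ ‖b‖ ≤ K ∧
      (∀ ξ, c * ‖ξ‖ ^ 2 ≤ ∑ i, inner ℝ ξ (a i) ^ 2) ∧ ∑ i, u'' w (a i) (a i) = u' w b)
    (hmax : ∀ w ∈ ball w₀ r, u w ≤ u w₀) :
    ∀ w ∈ ball w₀ (r / 2), u w = u w₀ := by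
  intro p hp
  by_contra hne
  rw [mem_ball] at hp
  set m := u w₀ with hm
  have hr : 0 < r := by linarith [dist_nonneg (x := p) (y := w₀)]
  have hcont : ContinuousOn u (ball w₀ r) := fun w hw =>
    (hu w hw).continuousAt.continuousWithinAt
  have hsub : closedBall p (dist p w₀) ⊆ ball w₀ r := fun y hy => by
    rw [mem_closedBall] at hy
    rw [mem_ball]
    linarith [dist_triangle y p w₀]
  -- `q` is a point of the contact set `{u = m}` that is nearest to `p`
  obtain ⟨q, ⟨hqball, hqm⟩, hqmin⟩ :
      ∃ q ∈ closedBall p (dist p w₀) ∩ {y | u y = m},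
        ∀ y ∈ closedBall p (dist p w₀) ∩ {y | u y = m}, dist q p ≤ dist y p := by
    have hcomp : IsCompact (closedBall p (dist p w₀) ∩ {y | u y = m}) := by
      refine (isCompact_closedBall p (dist p w₀)).of_isClosed_subset ?_ inter_subset_left
      exact (hcont.mono hsub).preimage_isClosed_of_isClosed isClosed_closedBall
        (isClosed_singleton (x := m))
    obtain ⟨q, hq, hq'⟩ := hcomp.exists_isMinOn ⟨w₀, by simp [dist_comm], hm.symm⟩
      (continuous_id.dist continuous_const).continuousOn
    exact ⟨q, hq, isMinOn_iff.1 hq'⟩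
  have hqm : u q = m := hqm
  have hqB := hsub hqball
  set R := dist q p with hR
  have hqp : q ≠ p := by rintro rfl; exact hne hqm
  have hRpos : 0 < R := dist_pos.2 hqp
  have hRle : R ≤ dist p w₀ := hqball
  have hlt : ∀ y, dist y p < R → u y < m := fun y hy => by
    have hyb : y ∈ closedBall p (dist p w₀) := (hy.le.trans hRle)
    refine lt_of_le_of_ne (hmax y (hsub hyb)) fun h => ?_
    exact absurd (hqmin y ⟨hyb, h⟩) (not_le.2 hy)
  -- a smaller ball, internally tangent at `q`, meets the contact set in `q` only
  set p' : W := p + (1 / 2 : ℝ) • (q - p) with hp'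
  have hqp' : ‖q - p'‖ = R / 2 := by
    have : q - p' = (1 / 2 : ℝ) • (q - p) := by rw [hp']; module
    rw [this, norm_smul, hR, dist_eq_norm]; norm_num; ring
  have hpp' : ‖p' - p‖ = R / 2 := by
    have : p' - p = (1 / 2 : ℝ) • (q - p) := by rw [hp']; module
    rw [this, norm_smul, hR, dist_eq_norm]; norm_num; ring
  have hlt' : ∀ y, ‖y - p'‖ ≤ R / 2 → y ≠ q → u y < m := fun y hy hyq => by
    refine hlt y ?_
    have hpar := parallelogram_law_with_norm ℝ (y - p') (p' - p)
    have h1 : y - p' + (p' - p) = y - p := by abel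
    have h2 : y - p' - (p' - p) = y - q := by rw [hp']; module
    rw [h1, h2, hpp'] at hpar
    have h3 : 0 < ‖y - q‖ := norm_pos_iff.2 (sub_ne_zero.2 hyq)
    rw [dist_eq_norm]
    have h4 := norm_nonneg (y - p')
    nlinarith [norm_nonneg (y - p)]
  -- a ball around `q` that avoids a neighbourhood of `p'`
  obtain ⟨ρ, hρ, hρR, hρB⟩ : ∃ ρ > 0, ρ ≤ R / 4 ∧ closedBall q ρ ⊆ ball w₀ r := by
    obtain ⟨ε, hε, h⟩ := Metric.nhds_basis_closedBall.mem_iff.1 (isOpen_ball.mem_nhds hqB)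
    exact ⟨min ε (R / 4), lt_min hε (by linarith), min_le_right _ _,
      (closedBall_subset_closedBall (min_le_left _ _)).trans h⟩
  have hnear : ∀ w ∈ closedBall q ρ, R / 4 ≤ ‖w - p'‖ ∧ ‖w - p'‖ ≤ R := fun w hw => by
    rw [mem_closedBall, dist_eq_norm] at hw
    constructor
    · have := norm_sub_norm_le (q - p') (q - w)
      have h : q - p' - (q - w) = w - p' := by abel
      rw [h, hqp', norm_sub_rev] at this
      linarith
    · have := norm_add_le (w - q) (q - p')
      have h : w - q + (q - p') = w - p' := by abel
      rw [h, hqp'] at this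
      linarith
  -- for large `k` the barrier is a strict subsolution on that ball
  obtain ⟨k, hk, hklarge⟩ : ∃ k > 0,
      Fintype.card ι * K ^ 2 + R * K < 2 * k * (c * (R / 4) ^ 2) := by
    have hpos : 0 < 2 * (c * (R / 4) ^ 2) := by positivity
    obtain ⟨k, hk⟩ := exists_gt (max 0 ((Fintype.card ι * K ^ 2 + R * K) / (2 * (c * (R / 4) ^ 2))))
    refine ⟨k, (le_max_left _ _).trans_lt hk, ?_⟩
    have := (div_lt_iff₀ hpos).1 ((le_max_right _ _).trans_lt hk)
    linarith
  set h := gaussianBarrier k p' with hh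
  have hhpos : ∀ w, 0 < h w := fun w => Real.exp_pos _
  have hhq : ∀ w, R / 2 < ‖w - p'‖ → h w < h q := fun w hw => by
    rw [hh]
    unfold gaussianBarrier
    rw [hqp']
    refine Real.exp_lt_exp.2 ?_
    have : (R / 2) ^ 2 < ‖w - p'‖ ^ 2 := by gcongr
    nlinarith
  have hhone : ∀ w, h w ≤ 1 := fun w => by
    rw [hh]
    unfold gaussianBarrier
    refine Real.exp_le_one_iff.2 ?_
    nlinarith [sq_nonneg ‖w - p'‖]
  obtain ⟨δ, hδ, hδle⟩ : ∃ δ > 0, ∀ y ∈ sphere q ρ ∩ closedBall p' (R / 2), u y ≤ m - δ := by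
    refine IsCompact.exists_lt_forall_le ((isCompact_sphere q ρ).inter_right isClosed_closedBall)
      (hcont.mono (inter_subset_left.trans (sphere_subset_closedBall.trans hρB))) ?_
    rintro y ⟨hy, hy'⟩
    rw [mem_closedBall, dist_eq_norm] at hy'
    refine hlt' y hy' ?_
    rintro rfl
    simp at hy
    exact hρ.ne hy
  set G : W → ℝ := fun w => u w + δ * h w with hG
  have hGder : ∀ w ∈ ball w₀ r, HasFDerivAt G
      (u' w + δ • ((-2 * k * h w) • realInnerL (w - p'))) w := fun w hw =>
    (hu w hw).add ((hasFDerivAt_gaussianBarrier k p' w).const_mul δ)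
  obtain ⟨w₁, hw₁, hw₁max⟩ := (isCompact_closedBall q ρ).exists_isMaxOn
    ⟨q, mem_closedBall_self hρ.le⟩
    (f := G) (fun w hw => (hGder w (hρB hw)).continuousAt.continuousWithinAt)
  rw [isMaxOn_iff] at hw₁max
  have hGq : m + δ * h q ≤ G w₁ := by
    have := hw₁max q (mem_closedBall_self hρ.le)
    simpa only [hG, hqm] using this
  have hw₁B := hρB hw₁
  -- on the sphere around `q` the perturbed function is below its value at `q`
  have hw₁ball : w₁ ∈ ball q ρ := by
    refine mem_ball.2 (lt_of_le_of_ne hw₁ fun hs => ?_)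
    have hGw : G w₁ = u w₁ + δ * h w₁ := rfl
    by_cases hle : ‖w₁ - p'‖ ≤ R / 2
    · have := hδle w₁ ⟨hs, by rwa [mem_closedBall, dist_eq_norm]⟩
      nlinarith [hhone w₁, hhpos q]
    · have h1 := hhq w₁ (not_le.1 hle)
      have h2 := hmax w₁ hw₁B
      nlinarith
  have hlocmax : IsLocalMax G w₁ := by
    filter_upwards [isOpen_ball.mem_nhds hw₁ball] with w hw
    exact hw₁max w (ball_subset_closedBall hw)
  have hcrit := hlocmax.hasFDerivAt_eq_zero (hGder w₁ hw₁B)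
  have hsecond := hlocmax.second_fderiv_nonpos
    (eventually_of_mem (isOpen_ball.mem_nhds hw₁B) hGder)
    ((hu' w₁ hw₁B).add ((hasFDerivAt_fderiv_gaussianBarrier k p' w₁).const_smul δ))
  obtain ⟨a, b, ha, hb, hab, heq⟩ := hell w₁ hw₁B
  obtain ⟨hlow, hupp⟩ := hnear w₁ hw₁
  have hcrit_b : u' w₁ b = 2 * k * δ * h w₁ * inner ℝ (w₁ - p') b := by
    have := congrArg (fun L : W →L[ℝ] ℝ => L b) hcrit
    simp at this
    rw [inner_sub_left]
    linarith
  have hsum : ∑ i, (u'' w₁ (a i) (a i) + δ * (-2 * k * h w₁ * ‖a i‖ ^ 2 +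
      4 * k ^ 2 * h w₁ * inner ℝ (w₁ - p') (a i) ^ 2)) ≤ 0 := by
    refine Finset.sum_nonpos fun i _ => ?_
    have := hsecond (a i)
    simp only [add_apply, smul_apply,
      ContinuousLinearMap.smulRight_apply, realInnerL_apply, real_inner_self_eq_norm_sq,
      smul_eq_mul, ← hh] at this
    linarith
  rw [Finset.sum_add_distrib, heq, hcrit_b, ← Finset.mul_sum, Finset.sum_add_distrib,
    ← Finset.mul_sum, ← Finset.mul_sum] at hsum
  have hK : 0 ≤ K := (norm_nonneg b).trans hb
  have hanorm : ∑ i, ‖a i‖ ^ 2 ≤ Fintype.card ι * K ^ 2 := by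
    calc ∑ i, ‖a i‖ ^ 2 ≤ ∑ _i : ι, K ^ 2 :=
          Finset.sum_le_sum fun i _ => by gcongr; exact ha i
      _ = Fintype.card ι * K ^ 2 := by simp
  have hbin : -(R * K) ≤ inner ℝ (w₁ - p') b := by
    have h1 := (abs_le.1 (abs_real_inner_le_norm (w₁ - p') b)).1
    have h2 : ‖w₁ - p'‖ * ‖b‖ ≤ R * K := by gcongr
    linarith
  have hlower : c * (R / 4) ^ 2 ≤ ∑ i, inner ℝ (w₁ - p') (a i) ^ 2 := by
    refine le_trans ?_ (hab (w₁ - p'))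
    gcongr
  set A := ∑ i, ‖a i‖ ^ 2
  set Q := ∑ i, inner ℝ (w₁ - p') (a i) ^ 2
  have hfac : 2 * k * δ * h w₁ * (inner ℝ (w₁ - p') b - A + 2 * k * Q) ≤ 0 := by
    linarith
  have hpos : 0 < 2 * k * δ * h w₁ := by have := hhpos w₁; positivity
  have h2kQ : 2 * k * (c * (R / 4) ^ 2) ≤ 2 * k * Q := by gcongr
  have := nonpos_of_mul_nonpos_right hfac hpos
  linarith

end MaximumPrinciple

/-! ### Embedded submanifolds: parametrizations, tangent spaces and gradients -/

section Submanifold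

set_option maxSynthPendingDepth 3

open Set Filter Topology Metric

variable {E : Type*} [NormedAddCommGroup E] [InnerProductSpace ℝ E] {M : Set E} {d : ℕ} {x : E}

theorem mem_tangentSpaceAt_of_hasDerivAt {γ : ℝ → E} {v : E} (h0 : γ 0 = x)
    (hM : ∀ᶠ t in 𝓝 0, γ t ∈ M) (hγ : HasDerivAt γ v 0) : v ∈ tangentSpaceAt M x :=
  Submodule.subset_span ⟨γ, h0, hM, hγ⟩

/-- Two linear maps that agree on the velocities of curves in `M` agree on the tangent space. -/
theorem eqOn_tangentSpaceAt {F : Type*} [AddCommGroup F] [Module ℝ F] {L L' : E →ₗ[ℝ] F}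
    (h : ∀ (γ : ℝ → E) (v : E), γ 0 = x → (∀ᶠ t in 𝓝 0, γ t ∈ M) → HasDerivAt γ v 0 → L v = L' v) :
    ∀ v ∈ tangentSpaceAt M x, L v = L' v := by
  intro v hv
  have hle : tangentSpaceAt M x ≤ LinearMap.eqLocus L L' := by
    refine Submodule.span_le.2 ?_
    rintro v ⟨γ, h0, hM, hγ⟩
    exact h γ v h0 hM hγ
  exact hle hv

/-- Derivatives within `M` need not be unique, but their restrictions to the tangent space are. -/
theorem HasFDerivWithinAt.eq_on_tangentSpaceAt {F : Type*} [NormedAddCommGroup F]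
    [NormedSpace ℝ F] {f : E → F} {L L' : E →L[ℝ] F} (h : HasFDerivWithinAt f L M x)
    (h' : HasFDerivWithinAt f L' M x) {v : E} (hv : v ∈ tangentSpaceAt M x) : L v = L' v := by
  refine eqOn_tangentSpaceAt (L := L.toLinearMap) (L' := L'.toLinearMap) ?_ v hv
  rintro γ v rfl hM hγ
  exact (h.comp_hasDerivAt 0 hγ hM).unique (h'.comp_hasDerivAt 0 hγ hM)

/-- `g` represents on the tangent space of `M` at `x` the derivative of `f` along `M`. If `g` is
tangent to `M`, it is the gradient of `f` with respect to the induced metric. -/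
def HasTangentGradAt (M : Set E) (f : E → ℝ) (g x : E) : Prop :=
  ∃ L : E →L[ℝ] ℝ, HasFDerivWithinAt f L M x ∧ ∀ v ∈ tangentSpaceAt M x, L v = inner ℝ g v

theorem HasTangentGradAt.sub {f f' : E → ℝ} {g g' : E} (h : HasTangentGradAt M f g x)
    (h' : HasTangentGradAt M f' g' x) : HasTangentGradAt M (fun y => f y - f' y) (g - g') x := by
  obtain ⟨L, hL, hg⟩ := h
  obtain ⟨L', hL', hg'⟩ := h'
  exact ⟨L - L', hL.sub hL', fun v hv => by simp [hg v hv, hg' v hv, inner_sub_left]⟩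

/-- A smooth parametrization of a `d`-dimensional submanifold `M` around its point `x` by a ball
centred at `0` in a Euclidean space of dimension `d`, together with a smooth left inverse defined
on the ambient space. -/
structure LocalParam (d : ℕ) (M : Set E) (x : E) where
  /-- the Euclidean space of coordinates -/
  model : Submodule ℝ E
  finrank_model : Module.finrank ℝ model = d
  /-- the radius of the coordinate ball -/
  radius : ℝ
  radius_pos : 0 < radius
  /-- the parametrization -/
  param : model → E
  /-- the coordinates of a point -/
  coord : E → model
  param_zero : param 0 = x
  contDiffOn_param : ContDiffOn ℝ ∞ param (ball 0 radius)
  param_mem : ∀ w ∈ ball 0 radius, param w ∈ M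
  coord_param : ∀ w ∈ ball 0 radius, coord (param w) = w
  contDiffAt_coord : ∀ w ∈ ball 0 radius, ContDiffAt ℝ ∞ coord (param w)
  eventually_param_coord : ∀ w ∈ ball 0 radius,
    ∀ᶠ y in 𝓝[M] (param w), coord y ∈ ball 0 radius ∧ param (coord y) = y

theorem IsEmbeddedSubmanifold.nonempty_localParam [FiniteDimensional ℝ E]
    (hM : IsEmbeddedSubmanifold d M) (hx : x ∈ M) : Nonempty (LocalParam d M x) := by
  obtain ⟨Φ, W, hxs, hΦ, hΦs, hW, hmem⟩ := hM x hx
  have hxW : Φ x ∈ W := (hmem x hxs).1 hx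
  obtain ⟨ρ, hρ, hball⟩ := Metric.isOpen_iff.1 Φ.open_target (Φ x) (Φ.map_source hxs)
  have htgt : ∀ w ∈ ball (0 : W) ρ, Φ x + w ∈ Φ.target := fun w hw =>
    hball (by simpa [dist_eq_norm] using hw)
  set ψ : W → E := fun w => Φ.symm (Φ x + w) with hψ
  set κ : E → W := fun y => W.orthogonalProjectionOnto (Φ y - Φ x) with hκ
  have hsrc : ∀ w ∈ ball (0 : W) ρ, ψ w ∈ Φ.source := fun w hw => Φ.map_target (htgt w hw)
  have hΦψ : ∀ w ∈ ball (0 : W) ρ, Φ (ψ w) = Φ x + w := fun w hw => Φ.right_inv (htgt w hw)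
  have hκψ : ∀ w ∈ ball (0 : W) ρ, κ (ψ w) = w := fun w hw => by
    simp [hκ, hΦψ w hw]
  have hκs : ∀ w ∈ ball (0 : W) ρ, ContDiffAt ℝ ∞ κ (ψ w) := fun w hw =>
    W.orthogonalProjectionOnto.contDiff.contDiffAt.comp (ψ w)
      ((hΦ.contDiffAt (Φ.open_source.mem_nhds (hsrc w hw))).sub contDiffAt_const)
  refine ⟨⟨W, hW, ρ, hρ, ψ, κ, ?_, ?_, ?_, hκψ, hκs, ?_⟩⟩
  · simp [hψ, Φ.left_inv hxs]
  · exact hΦs.comp (contDiff_const.add W.subtypeL.contDiff).contDiffOn htgt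
  · intro w hw
    rw [hmem _ (hsrc w hw), hΦψ w hw]
    exact W.add_mem hxW w.2
  · intro w hw
    have h1 : ∀ᶠ y in 𝓝[M] (ψ w), y ∈ Φ.source :=
      nhdsWithin_le_nhds (Φ.open_source.mem_nhds (hsrc w hw))
    have h2 : ∀ᶠ y in 𝓝[M] (ψ w), κ y ∈ ball (0 : W) ρ := by
      refine nhdsWithin_le_nhds ((hκs w hw).continuousAt ?_)
      rw [hκψ w hw]
      exact isOpen_ball.mem_nhds hw
    filter_upwards [h1, h2, self_mem_nhdsWithin] with y hy1 hy2 hyM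
    refine ⟨hy2, ?_⟩
    have hyW : Φ y - Φ x ∈ W := W.sub_mem ((hmem y hy1).1 hyM) hxW
    have hproj : ((κ y : W) : E) = Φ y - Φ x :=
      congrArg Subtype.val (W.orthogonalProjectionOnto_mem_subspace_eq_self ⟨_, hyW⟩)
    simp only [hψ, hproj, add_sub_cancel, Φ.left_inv hy1]

namespace LocalParam

variable (p : LocalParam d M x)

/-- The derivative of the parametrization. -/
noncomputable def deriv (w : p.model) : p.model →L[ℝ] E := fderiv ℝ p.param w

/-- The derivative of the coordinates at a point of the submanifold. -/
noncomputable def coordDeriv (w : p.model) : E →L[ℝ] p.model := fderiv ℝ p.coord (p.param w)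

theorem zero_mem : (0 : p.model) ∈ ball (0 : p.model) p.radius := mem_ball_self p.radius_pos

variable {p} {w : p.model}

theorem contDiffAt_param (hw : w ∈ ball 0 p.radius) : ContDiffAt ℝ ∞ p.param w :=
  p.contDiffOn_param.contDiffAt (isOpen_ball.mem_nhds hw)

theorem hasFDerivAt_param (hw : w ∈ ball 0 p.radius) : HasFDerivAt p.param (p.deriv w) w :=
  ((contDiffAt_param hw).differentiableAt (by simp)).hasFDerivAt

theorem contDiffAt_deriv (hw : w ∈ ball 0 p.radius) : ContDiffAt ℝ ∞ p.deriv w :=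
  (contDiffAt_param hw).fderiv_right (by simp)

theorem hasFDerivAt_coord (hw : w ∈ ball 0 p.radius) :
    HasFDerivAt p.coord (p.coordDeriv w) (p.param w) :=
  ((p.contDiffAt_coord w hw).differentiableAt (by simp)).hasFDerivAt

theorem continuousAt_coordDeriv (hw : w ∈ ball 0 p.radius) : ContinuousAt p.coordDeriv w :=
  ContinuousAt.comp (f := p.param) (g := fderiv ℝ p.coord)
    ((p.contDiffAt_coord w hw).fderiv_right (m := ∞) (by simp)).continuousAt
    (contDiffAt_param hw).continuousAt

variable (p) in
theorem eventually_coord_mem_ball {ρ : ℝ} (hρ : 0 < ρ) :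
    ∀ᶠ y in 𝓝[M] x, p.coord y ∈ ball (0 : p.model) ρ ∧ p.param (p.coord y) = y := by
  have hc := (p.contDiffAt_coord 0 p.zero_mem).continuousAt
  have hc0 := p.coord_param 0 p.zero_mem
  have e := p.eventually_param_coord 0 p.zero_mem
  rw [p.param_zero] at hc hc0 e
  have h : ∀ᶠ y in 𝓝[M] x, p.coord y ∈ ball (0 : p.model) ρ := by
    refine nhdsWithin_le_nhds (hc ?_)
    rw [hc0]
    exact ball_mem_nhds 0 hρ
  filter_upwards [h, e] with y hy1 hy2 using ⟨hy1, hy2.2⟩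

theorem coordDeriv_deriv (hw : w ∈ ball 0 p.radius) (a : p.model) :
    p.coordDeriv w (p.deriv w a) = a := by
  have h1 := (hasFDerivAt_coord hw).comp w (hasFDerivAt_param hw)
  have h2 : p.coord ∘ p.param =ᶠ[𝓝 w] id :=
    eventually_of_mem (isOpen_ball.mem_nhds hw) p.coord_param
  have h3 := h1.unique ((hasFDerivAt_id w).congr_of_eventuallyEq h2)
  exact congrArg (fun L : p.model →L[ℝ] p.model => L a) h3

theorem deriv_mem_tangentSpaceAt (hw : w ∈ ball 0 p.radius) (a : p.model) :
    p.deriv w a ∈ tangentSpaceAt M (p.param w) := by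
  have hline : HasDerivAt (fun t : ℝ => w + t • a) a 0 := by
    simpa using ((hasDerivAt_id (0 : ℝ)).smul_const a).const_add w
  have h0 : (fun t : ℝ => w + t • a) 0 = w := by simp
  have h1 : HasFDerivAt p.param (p.deriv w) ((fun t : ℝ => w + t • a) 0) := by
    rw [h0]; exact hasFDerivAt_param hw
  refine mem_tangentSpaceAt_of_hasDerivAt (γ := fun t : ℝ => p.param (w + t • a)) (by simp) ?_
    (h1.comp_hasDerivAt 0 hline)
  have h2 : ∀ᶠ t : ℝ in 𝓝 0, w + t • a ∈ ball 0 p.radius :=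
    hline.continuousAt (isOpen_ball.mem_nhds (by simpa using hw))
  exact h2.mono fun t ht => p.param_mem _ ht

theorem deriv_coordDeriv (hw : w ∈ ball 0 p.radius) {v : E}
    (hv : v ∈ tangentSpaceAt M (p.param w)) : p.deriv w (p.coordDeriv w v) = v := by
  refine eqOn_tangentSpaceAt (L := ((p.deriv w).comp (p.coordDeriv w)).toLinearMap)
    (L' := LinearMap.id) ?_ v hv
  intro γ v h0 hM hγ
  have h1 : HasFDerivAt p.coord (p.coordDeriv w) (γ 0) := by rw [h0]; exact hasFDerivAt_coord hw
  have h2 : HasFDerivAt p.param (p.deriv w) (p.coord (γ 0)) := by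
    rw [h0, p.coord_param w hw]; exact hasFDerivAt_param hw
  have h3 := h2.comp_hasDerivAt 0 (h1.comp_hasDerivAt 0 hγ)
  have htend : Tendsto γ (𝓝 0) (𝓝[M] (p.param w)) := by
    rw [← h0]
    exact tendsto_nhdsWithin_iff.2 ⟨hγ.continuousAt, hM⟩
  have h4 : p.param ∘ p.coord ∘ γ =ᶠ[𝓝 0] γ :=
    (htend.eventually (p.eventually_param_coord w hw)).mono fun t ht => ht.2
  exact h3.unique (hγ.congr_of_eventuallyEq h4)

theorem finrank_tangentSpaceAt (hw : w ∈ ball 0 p.radius) :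
    Module.finrank ℝ (tangentSpaceAt M (p.param w)) = d := by
  have hrange : LinearMap.range (p.deriv w).toLinearMap = tangentSpaceAt M (p.param w) := by
    refine le_antisymm ?_ fun v hv => ⟨p.coordDeriv w v, deriv_coordDeriv hw hv⟩
    rintro _ ⟨a, rfl⟩
    exact deriv_mem_tangentSpaceAt hw a
  rw [← hrange, LinearMap.finrank_range_of_inj, p.finrank_model]
  intro a b hab
  have := congrArg (p.coordDeriv w) hab
  rwa [ContinuousLinearMap.coe_coe, coordDeriv_deriv hw, coordDeriv_deriv hw] at this

theorem hasFDerivAt_comp_param {F : Type*} [NormedAddCommGroup F] [NormedSpace ℝ F] {f : E → F}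
    {L : E →L[ℝ] F} (hw : w ∈ ball 0 p.radius) (hf : HasFDerivWithinAt f L M (p.param w)) :
    HasFDerivAt (fun w => f (p.param w)) (L.comp (p.deriv w)) w := by
  have h := hf.comp w (hasFDerivAt_param hw).hasFDerivWithinAt (s := ball 0 p.radius) p.param_mem
  exact h.hasFDerivAt (isOpen_ball.mem_nhds hw)

theorem hasFDerivAt_comp_param_of_hasTangentGradAt {f : E → ℝ} {g : E} (hw : w ∈ ball 0 p.radius)
    (hf : HasTangentGradAt M f g (p.param w)) :
    HasFDerivAt (fun w => f (p.param w)) ((realInnerL g).comp (p.deriv w)) w := by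
  obtain ⟨L, hL, hLg⟩ := hf
  refine (hasFDerivAt_comp_param hw hL).congr_fderiv ?_
  ext a
  exact hLg _ (deriv_mem_tangentSpaceAt hw a)

/-- The derivative of the pull back of the 1-form `⟪V, ·⟫` along the parametrization. -/
theorem hasFDerivAt_pullback [FiniteDimensional ℝ E] {V : E → E} {L : E →L[ℝ] E}
    (hw : w ∈ ball 0 p.radius) (hV : HasFDerivWithinAt V L M (p.param w)) :
    ∃ B : p.model →L[ℝ] p.model →L[ℝ] ℝ,
      HasFDerivAt (fun w => (realInnerL (V (p.param w))).comp (p.deriv w)) B w ∧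
      ∀ a b, B a b = inner ℝ (L (p.deriv w a)) (p.deriv w b) +
        inner ℝ (V (p.param w)) (fderiv ℝ p.deriv w a b) := by
  have h1 : HasFDerivAt (fun w => realInnerL (V (p.param w)))
      ((realInnerL (W := E)).comp (L.comp (p.deriv w))) w :=
    (realInnerL (W := E)).hasFDerivAt.comp w (hasFDerivAt_comp_param hw hV)
  have h2 : HasFDerivAt p.deriv (fderiv ℝ p.deriv w) w :=
    ((contDiffAt_deriv hw).differentiableAt (by simp)).hasFDerivAt
  refine ⟨_, h1.clm_comp h2, fun a b => ?_⟩
  simp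
  ring

end LocalParam

theorem IsEmbeddedSubmanifold.finrank_tangentSpaceAt [FiniteDimensional ℝ E]
    (hM : IsEmbeddedSubmanifold d M) (hx : x ∈ M) :
    Module.finrank ℝ (tangentSpaceAt M x) = d := by
  obtain ⟨p⟩ := hM.nonempty_localParam hx
  have h := p.finrank_tangentSpaceAt p.zero_mem
  rwa [p.param_zero] at h

/-! ### Tangential divergence and the maximum principles on a submanifold -/

variable [FiniteDimensional ℝ E]

/-- The divergence along `M` of a vector field: the trace over the tangent space of the tangential
part of its derivative. -/
noncomputable def tangentialDivergence (M : Set E) (V : E → E) (x : E) : ℝ :=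
  LinearMap.trace ℝ (tangentSpaceAt M x)
    (((tangentSpaceAt M x).orthogonalProjectionOnto.comp
      ((fderivWithin ℝ V M x).comp (tangentSpaceAt M x).subtypeL)) :
        tangentSpaceAt M x →ₗ[ℝ] tangentSpaceAt M x)

theorem tangentialDivergence_eq_sum {ι : Type*} [Fintype ι] {V : E → E} {L : E →L[ℝ] E}
    (hV : HasFDerivWithinAt V L M x) (b : OrthonormalBasis ι ℝ (tangentSpaceAt M x)) :
    tangentialDivergence M V x = ∑ i, inner ℝ (L (b i)) (b i : E) := by
  rw [tangentialDivergence, LinearMap.trace_eq_sum_inner _ b]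
  refine Finset.sum_congr rfl fun i _ => ?_
  have h : fderivWithin ℝ V M x (b i) = L (b i) :=
    hV.differentiableWithinAt.hasFDerivWithinAt.eq_on_tangentSpaceAt hV (b i).2
  simp [real_inner_comm, h]

/-- At a maximum on `M` of a function, the divergence of its gradient is not positive. -/
theorem tangentialDivergence_nonpos_of_isMaxOn (hM : IsEmbeddedSubmanifold d M) (hx : x ∈ M)
    {f : E → ℝ} {V : E → E} (hf : ∀ y ∈ M, HasTangentGradAt M f (V y) y)
    (hVx : V x ∈ tangentSpaceAt M x) (hV : DifferentiableWithinAt ℝ V M x)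
    (hmax : ∀ y ∈ M, f y ≤ f x) : tangentialDivergence M V x ≤ 0 := by
  obtain ⟨p⟩ := hM.nonempty_localParam hx
  have h0 := p.zero_mem
  have hu : ∀ w ∈ ball 0 p.radius, HasFDerivAt (fun w => f (p.param w))
      ((realInnerL (V (p.param w))).comp (p.deriv w)) w := fun w hw =>
    p.hasFDerivAt_comp_param_of_hasTangentGradAt hw (hf _ (p.param_mem w hw))
  obtain ⟨B, hB, hBeq⟩ := p.hasFDerivAt_pullback h0
    (p.param_zero.symm ▸ hV.hasFDerivWithinAt)
  have hloc : IsLocalMax (fun w => f (p.param w)) 0 := by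
    filter_upwards [isOpen_ball.mem_nhds h0] with w hw
    rw [p.param_zero]
    exact hmax _ (p.param_mem w hw)
  -- the gradient vanishes at the maximum, so that the curvature of the parametrization does not
  -- contribute to the second derivative
  have hVzero : V x = 0 := by
    have h1 := hloc.hasFDerivAt_eq_zero (hu 0 h0)
    have h2 := congrArg (fun L : p.model →L[ℝ] ℝ => L (p.coordDeriv 0 (V x))) h1
    simp only [ContinuousLinearMap.comp_apply, realInnerL_apply] at h2
    rw [p.deriv_coordDeriv h0 (by rwa [p.param_zero]), p.param_zero] at h2
    exact inner_self_eq_zero.1 h2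
  rw [tangentialDivergence_eq_sum hV.hasFDerivWithinAt (stdOrthonormalBasis ℝ _)]
  refine Finset.sum_nonpos fun i _ => ?_
  set v := stdOrthonormalBasis ℝ (tangentSpaceAt M x) i
  have h3 := hloc.second_fderiv_nonpos (eventually_of_mem (isOpen_ball.mem_nhds h0) hu) hB
    (p.coordDeriv 0 v)
  rw [hBeq, p.deriv_coordDeriv h0 (by rw [p.param_zero]; exact v.2), p.param_zero, hVzero] at h3
  simpa using h3

/-- The strong maximum principle for harmonic functions on a submanifold: where such a function
attains its maximum, it is locally constant. -/
theorem eventually_eq_of_isMaxOn_of_tangentialDivergence_eq_zero (hM : IsEmbeddedSubmanifold d M)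
    (hx : x ∈ M) {f : E → ℝ} {V : E → E} (hf : ∀ y ∈ M, HasTangentGradAt M f (V y) y)
    (hVt : ∀ y ∈ M, V y ∈ tangentSpaceAt M y) (hV : DifferentiableOn ℝ V M)
    (hdiv : ∀ y ∈ M, tangentialDivergence M V y = 0) (hmax : ∀ y ∈ M, f y ≤ f x) :
    ∀ᶠ y in 𝓝[M] x, f y = f x := by
  obtain ⟨p⟩ := hM.nonempty_localParam hx
  have h0 := p.zero_mem
  -- bounds, near the centre, for the derivatives of the parametrization and of the coordinates
  obtain ⟨A, hA1, r, hr, hrp, hD, hK, hDD⟩ : ∃ A : ℝ, 1 ≤ A ∧ ∃ r > 0,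
      ball (0 : p.model) r ⊆ ball 0 p.radius ∧ (∀ w ∈ ball (0 : p.model) r, ‖p.deriv w‖ ≤ A) ∧
      (∀ w ∈ ball (0 : p.model) r, ‖p.coordDeriv w‖ ≤ A) ∧
      ∀ w ∈ ball (0 : p.model) r, ‖fderiv ℝ p.deriv w‖ ≤ A := by
    set A := 1 + ‖p.deriv 0‖ + ‖p.coordDeriv 0‖ + ‖fderiv ℝ p.deriv 0‖
    have n1 := norm_nonneg (p.deriv 0)
    have n2 := norm_nonneg (p.coordDeriv 0)
    have n3 := norm_nonneg (fderiv ℝ p.deriv 0)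
    have e1 : ∀ᶠ w in 𝓝 (0 : p.model), ‖p.deriv w‖ < A :=
      (p.contDiffAt_deriv h0).continuousAt.norm.eventually_lt_const (by linarith)
    have e2 : ∀ᶠ w in 𝓝 (0 : p.model), ‖p.coordDeriv w‖ < A :=
      (p.continuousAt_coordDeriv h0).norm.eventually_lt_const (by linarith)
    have e3 : ∀ᶠ w in 𝓝 (0 : p.model), ‖fderiv ℝ p.deriv w‖ < A :=
      ((p.contDiffAt_deriv h0).fderiv_right (m := ∞)
        (by simp)).continuousAt.norm.eventually_lt_const (by linarith)
    obtain ⟨r, hr, h⟩ := Metric.mem_nhds_iff.1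
      (e1.and (e2.and (e3.and (isOpen_ball.mem_nhds h0))))
    exact ⟨A, by linarith, r, hr, fun w hw => (h hw).2.2.2, fun w hw => (h hw).1.le,
      fun w hw => (h hw).2.1.le, fun w hw => (h hw).2.2.1.le⟩
  have hA0 : 0 < A := by linarith
  have hu : ∀ w ∈ ball 0 p.radius, HasFDerivAt (fun w => f (p.param w))
      ((realInnerL (V (p.param w))).comp (p.deriv w)) w := fun w hw =>
    p.hasFDerivAt_comp_param_of_hasTangentGradAt hw (hf _ (p.param_mem w hw))
  have hB : ∀ w : p.model, ∃ B : p.model →L[ℝ] p.model →L[ℝ] ℝ, w ∈ ball 0 p.radius →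
      HasFDerivAt (fun w => (realInnerL (V (p.param w))).comp (p.deriv w)) B w ∧
      ∀ a b, B a b = inner ℝ (fderivWithin ℝ V M (p.param w) (p.deriv w a)) (p.deriv w b) +
        inner ℝ (V (p.param w)) (fderiv ℝ p.deriv w a b) := fun w => by
    by_cases hw : w ∈ ball 0 p.radius
    · obtain ⟨B, h⟩ := p.hasFDerivAt_pullback hw (hV _ (p.param_mem w hw)).hasFDerivWithinAt
      exact ⟨B, fun _ => h⟩
    · exact ⟨0, fun h => absurd h hw⟩
  choose B hB using hB
  have hconst := eq_of_isMaxOn_ball_of_elliptic (ι := Fin d) (w₀ := (0 : p.model)) (r := r)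
    (K := max A (A * (d * (A * A * A)))) (c := (A ^ 2)⁻¹) (by positivity)
    (fun w hw => hu w (hrp hw)) (fun w hw => (hB w (hrp hw)).1) ?_
    (fun w hw => by rw [p.param_zero]; exact hmax _ (p.param_mem w (hrp hw)))
  · filter_upwards [p.eventually_coord_mem_ball (half_pos hr)] with y hy
    have := hconst _ hy.1
    rwa [hy.2, p.param_zero] at this
  -- in coordinates, the Laplace equation is elliptic with bounded coefficients
  · intro w hwr
    have hw := hrp hwr
    have hy := p.param_mem w hw
    set T := tangentSpaceAt M (p.param w) with hT
    let e : OrthonormalBasis (Fin d) ℝ T :=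
      (stdOrthonormalBasis ℝ T).reindex (finCongr (p.finrank_tangentSpaceAt hw))
    set a : Fin d → p.model := fun i => p.coordDeriv w (e i) with ha
    have hDa : ∀ i, p.deriv w (a i) = e i := fun i => p.deriv_coordDeriv hw (e i).2
    have hanorm : ∀ i, ‖a i‖ ≤ A := fun i => by
      have h1 := (p.coordDeriv w).le_of_opNorm_le (hK w hwr) (e i : E)
      have h2 : ‖(e i : E)‖ = 1 := e.orthonormal.1 i
      simpa [h2] using h1
    set z : E := ∑ i, fderiv ℝ p.deriv w (a i) (a i) with hz
    have hznorm : ‖z‖ ≤ d * (A * A * A) := by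
      refine (norm_sum_le _ _).trans ?_
      calc ∑ i, ‖fderiv ℝ p.deriv w (a i) (a i)‖ ≤ ∑ _i : Fin d, A * A * A := by
            refine Finset.sum_le_sum fun i _ => ?_
            refine (ContinuousLinearMap.le_opNorm₂ _ _ _).trans ?_
            have := hDD w hwr
            have := hanorm i
            gcongr
        _ = d * (A * A * A) := by simp
    refine ⟨a, p.coordDeriv w (T.orthogonalProjectionOnto z : E),
      fun i => (hanorm i).trans (le_max_left _ _), ?_, ?_, ?_⟩
    · refine le_trans ?_ (le_max_right _ _)
      refine ((p.coordDeriv w).le_of_opNorm_le (hK w hwr) _).trans ?_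
      have h1 : ‖(T.orthogonalProjectionOnto z : E)‖ ≤ ‖z‖ :=
        T.norm_orthogonalProjectionOnto_apply_le z
      gcongr
      exact h1.trans hznorm
    · intro ξ
      -- `ξ` is recovered from its image, which is expanded in the orthonormal basis
      set η : T := ⟨p.deriv w ξ, p.deriv_mem_tangentSpaceAt hw ξ⟩ with hη
      have hexp : ξ = ∑ i, inner ℝ (e i) η • a i := by
        have h1 := congrArg (fun y : T => p.coordDeriv w (y : E)) (e.sum_repr' η)
        simp only [AddSubmonoidClass.coe_finsetSum, Submodule.coe_smul, map_sum, map_smul] at h1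
        rw [h1, hη, p.coordDeriv_deriv hw]
      have h2 : ‖ξ‖ ^ 2 = ∑ i, inner ℝ (e i) η * inner ℝ ξ (a i) := by
        rw [← real_inner_self_eq_norm_sq]
        nth_rewrite 2 [hexp]
        simp [inner_sum, inner_smul_right]
      have h3 : ∑ i, inner ℝ (e i) η ^ 2 = ‖η‖ ^ 2 := by
        simpa using e.sum_sq_norm_inner_right η
      have h4 : ‖η‖ ≤ A * ‖ξ‖ := (p.deriv w).le_of_opNorm_le (hD w hwr) ξ
      have h5 := Finset.sum_mul_sq_le_sq_mul_sq Finset.univ (fun i => inner ℝ (e i) η)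
        (fun i => inner ℝ ξ (a i))
      rw [← h2, h3] at h5
      set Q := ∑ i, inner ℝ ξ (a i) ^ 2
      have hQ : 0 ≤ Q := Finset.sum_nonneg fun i _ => sq_nonneg _
      rcases (norm_nonneg ξ).eq_or_lt with hξ | hξ
      · rw [← hξ]; simpa using hQ
      · rw [inv_mul_le_iff₀ (by positivity)]
        have h6 : ‖η‖ ^ 2 * Q ≤ (A * ‖ξ‖) ^ 2 * Q := by gcongr
        have h7 : ‖ξ‖ ^ 2 * ‖ξ‖ ^ 2 ≤ ‖ξ‖ ^ 2 * (A ^ 2 * Q) := by nlinarith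
        exact le_of_mul_le_mul_left h7 (by positivity)
    · have h1 := hdiv _ hy
      rw [tangentialDivergence_eq_sum (hV _ hy).hasFDerivWithinAt e] at h1
      have h2 : ∑ i, B w (a i) (a i) = inner ℝ (V (p.param w)) z := by
        simp only [(hB w hw).2, hDa, Finset.sum_add_distrib, h1, zero_add, hz, inner_sum]
      rw [h2, ContinuousLinearMap.comp_apply, realInnerL_apply,
        p.deriv_coordDeriv hw (T.orthogonalProjectionOnto z).2]
      exact (Submodule.inner_orthogonalProjectionOnto_eq_of_mem_left ⟨_, hVt _ hy⟩ z).symm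

end Submanifold

/-! ### Primitives of closed fields -/

section Primitives

set_option maxSynthPendingDepth 3

open Set Filter Topology Metric

/-- The bundle with discrete fiber `A` in which the sections are the families of functions
`f i + c i`: over `U i` it is trivialized by the coordinate `c i`. -/
def additiveCocycleCore {X A : Type*} [TopologicalSpace X] [AddCommGroup A] [TopologicalSpace A]
    [DiscreteTopology A] (U : X → Set X) (f : X → X → A) (hU : ∀ i, IsOpen (U i))
    (hmem : ∀ i, i ∈ U i) (hf : ∀ i j, ∀ z ∈ U i ∩ U j,
      ∀ᶠ y in 𝓝 z, f i y - f j y = f i z - f j z) : FiberBundleCore X X A where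
  baseSet := U
  isOpen_baseSet := hU
  indexAt := id
  mem_baseSet_at := hmem
  coordChange i j z v := v + (f i z - f j z)
  coordChange_self i z _ v := by simp
  continuousOn_coordChange i j := by
    have h : ContinuousOn (fun z => f i z - f j z) (U i ∩ U j) := fun z hz =>
      (continuousAt_const.congr ((hf i j z hz).mono fun y hy => hy.symm)).continuousWithinAt
    exact continuousOn_snd.add (h.comp continuousOn_fst fun p hp => hp.1)
  coordChange_comp i j k z _ v := by abel

/-- On a simply connected and locally path connected space, functions that are given locally and
whose differences are locally constant can be glued after adding locally constant functions: the
corresponding covering space has a section. -/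
theorem exists_glue_of_sub_locallyConstant {X A : Type*} [TopologicalSpace X]
    [SimplyConnectedSpace X] [LocallyPathConnectedSpace X] [AddCommGroup A] (U : X → Set X)
    (f : X → X → A) (hU : ∀ i, IsOpen (U i)) (hmem : ∀ i, i ∈ U i)
    (hf : ∀ i j, ∀ z ∈ U i ∩ U j, ∀ᶠ y in 𝓝 z, f i y - f j y = f i z - f j z) :
    ∃ F : X → A, ∀ i, ∀ᶠ y in 𝓝 i, F y - f i y = F i - f i i := by
  let _ : TopologicalSpace A := ⊥
  have : DiscreteTopology A := ⟨rfl⟩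
  set Z := additiveCocycleCore U f hU hmem hf
  have hcov : IsCoveringMap Z.proj := FiberBundle.isCoveringMap (F := A) (E := Z.Fiber)
  obtain ⟨x₀⟩ : Nonempty X := inferInstance
  obtain ⟨s, ⟨-, hs⟩, -⟩ := hcov.existsUnique_continuousMap_lifts (ContinuousMap.id X) x₀
    (⟨x₀, (0 : A)⟩ : Z.TotalSpace) rfl
  have hs1 : ∀ z, (s z).1 = z := fun z => congrFun hs z
  let c : X → A := fun z => (s z).2
  refine ⟨fun z => f z z + c z, fun i => ?_⟩
  have hcoord : ∀ z, (Z.localTriv i (s z)).2 = f z z + c z - f i z := fun z => by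
    have h : (Z.localTriv i (s z)).2 = c z + (f (s z).1 (s z).1 - f i (s z).1) := rfl
    rw [h, hs1]
    abel
  have hsrc : s i ∈ (Z.localTriv i).source := by
    rw [Z.mem_localTriv_source, hs1]
    exact hmem i
  have hcont : ContinuousAt (fun z => (Z.localTriv i (s z)).2) i :=
    continuous_snd.continuousAt.comp
      (((Z.localTriv i).continuousAt hsrc).comp s.continuous.continuousAt)
  have hev := hcont.eventually_mem
    ((isOpen_discrete {(Z.localTriv i (s i)).2}).mem_nhds (mem_singleton _))
  filter_upwards [hev] with z hz
  rw [mem_singleton_iff, hcoord, hcoord] at hz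
  exact hz

variable {E : Type*} [NormedAddCommGroup E] [InnerProductSpace ℝ E] [FiniteDimensional ℝ E]
  {M : Set E} {d : ℕ} {x : E}

theorem IsEmbeddedSubmanifold.locallyPathConnectedSpace (hM : IsEmbeddedSubmanifold d M) :
    LocallyPathConnectedSpace M := by
  refine ⟨fun x => hasBasis_self.2 fun t ht => ?_⟩
  obtain ⟨t', ht', htt'⟩ := mem_nhds_subtype M x t |>.1 ht
  obtain ⟨p⟩ := hM.nonempty_localParam x.2
  have h0 := p.zero_mem
  have hpre : p.param ⁻¹' t' ∈ 𝓝 0 := by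
    refine (p.contDiffAt_param h0).continuousAt ?_
    rwa [p.param_zero]
  obtain ⟨ρ, hρ, hball⟩ := Metric.mem_nhds_iff.1 (inter_mem hpre (isOpen_ball.mem_nhds h0))
  have himage : Subtype.val '' (Subtype.val ⁻¹' (p.param '' ball 0 ρ) : Set M) =
      p.param '' ball 0 ρ := by
    rw [Subtype.image_preimage_coe, inter_eq_right]
    rintro _ ⟨w, hw, rfl⟩
    exact p.param_mem w (hball hw).2
  refine ⟨Subtype.val ⁻¹' (p.param '' ball 0 ρ), ?_, ?_, ?_⟩
  · rw [mem_nhds_subtype_iff_nhdsWithin, himage]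
    filter_upwards [p.eventually_coord_mem_ball hρ] with y hy using ⟨p.coord y, hy⟩
  · rw [IsInducing.subtypeVal.isPathConnected_iff, himage]
    exact ((convex_ball (0 : p.model) ρ).isPathConnected ⟨0, mem_ball_self hρ⟩).image'
      (p.contDiffOn_param.continuousOn.mono fun w hw => (hball hw).2)
  · rintro y ⟨w, hw, hwy⟩
    refine htt' ?_
    rw [mem_preimage, ← hwy]
    exact (hball hw).1

/-- The Poincaré lemma on a submanifold: a field whose derivative is symmetric on the tangent spaces
is locally a gradient. -/
theorem IsEmbeddedSubmanifold.exists_hasTangentGradAt (hM : IsEmbeddedSubmanifold d M)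
    (hx : x ∈ M) {V : E → E} (hV : DifferentiableOn ℝ V M)
    (hsymm : ∀ y ∈ M, ∀ u ∈ tangentSpaceAt M y, ∀ v ∈ tangentSpaceAt M y,
      inner ℝ (fderivWithin ℝ V M y u) v = inner ℝ (fderivWithin ℝ V M y v) u) :
    ∃ f : E → ℝ, ∀ᶠ y in 𝓝[M] x, HasTangentGradAt M f (V y) y := by
  obtain ⟨p⟩ := hM.nonempty_localParam hx
  have hconv := convex_ball (0 : p.model) p.radius
  obtain ⟨g, hg⟩ := hconv.exists_forall_hasFDerivAt_of_fderiv_symmetric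
    (E := p.model) (F := ℝ) isOpen_ball
    (show DifferentiableOn ℝ (fun w => (realInnerL (V (p.param w))).comp (p.deriv w)) _ from
      fun w hw => by
      obtain ⟨B, hB, -⟩ := p.hasFDerivAt_pullback hw (hV _ (p.param_mem w hw)).hasFDerivWithinAt
      exact hB.differentiableAt.differentiableWithinAt)
    (fun w hw a b => by
      obtain ⟨B, hB, hBeq⟩ := p.hasFDerivAt_pullback hw
        (hV _ (p.param_mem w hw)).hasFDerivWithinAt
      have h2 : fderiv ℝ p.deriv w a b = fderiv ℝ p.deriv w b a :=
        (p.contDiffAt_param hw).isSymmSndFDerivAt 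
          (by simpa using WithTop.coe_le_coe.2 (le_top (a := (2 : ℕ∞)))) a b
      rw [hB.fderiv, hBeq, hBeq, h2, hsymm _ (p.param_mem w hw) _
        (p.deriv_mem_tangentSpaceAt hw a) _ (p.deriv_mem_tangentSpaceAt hw b)])
  refine ⟨fun y => g (p.coord y), ?_⟩
  have hev := p.eventually_param_coord 0 p.zero_mem
  rw [p.param_zero] at hev
  filter_upwards [hev] with y hy
  have h1 : HasFDerivAt p.coord (p.coordDeriv (p.coord y)) y := by
    have := p.hasFDerivAt_coord hy.1
    rwa [hy.2] at this
  refine ⟨_, ((hg _ hy.1).comp y h1).hasFDerivWithinAt, fun v hv => ?_⟩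
  have h2 := p.deriv_coordDeriv hy.1 (v := v) (by rwa [hy.2])
  simp [h2, hy.2]

/-- A function on a submanifold whose gradient vanishes is locally constant. -/
theorem IsEmbeddedSubmanifold.eventually_eq_of_hasTangentGradAt_zero
    (hM : IsEmbeddedSubmanifold d M) (hx : x ∈ M) {f : E → ℝ}
    (hf : ∀ᶠ y in 𝓝[M] x, HasTangentGradAt M f 0 y) : ∀ᶠ y in 𝓝[M] x, f y = f x := by
  obtain ⟨p⟩ := hM.nonempty_localParam hx
  have h0 := p.zero_mem
  have htend : Tendsto p.param (𝓝 0) (𝓝[M] x) := by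
    refine tendsto_nhdsWithin_iff.2 ⟨?_, eventually_of_mem (isOpen_ball.mem_nhds h0) p.param_mem⟩
    have := (p.contDiffAt_param h0).continuousAt.tendsto
    rwa [p.param_zero] at this
  obtain ⟨r, hr, hball⟩ := Metric.mem_nhds_iff.1
    (inter_mem (htend.eventually hf) (isOpen_ball.mem_nhds h0))
  have hder : ∀ w ∈ ball (0 : p.model) r,
      HasFDerivAt (fun w => f (p.param w)) (0 : p.model →L[ℝ] ℝ) w := by
    intro w hw
    refine (p.hasFDerivAt_comp_param_of_hasTangentGradAt (hball hw).2 (hball hw).1).congr_fderiv ?_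
    simp
  have hconst : ∀ w ∈ ball (0 : p.model) r, f (p.param w) = f x := by
    intro w hw
    have := isOpen_ball.is_const_of_fderiv_eq_zero (𝕜 := ℝ)
      (f := fun w => f (p.param w)) (convex_ball (0 : p.model) r).isPreconnected
      (fun w hw => (hder w hw).differentiableAt.differentiableWithinAt)
      (fun w hw => (hder w hw).fderiv) hw (mem_ball_self hr)
    simpa [p.param_zero] using this
  filter_upwards [p.eventually_coord_mem_ball hr] with y hy
  have := hconst _ hy.1
  rwa [hy.2] at this

end Primitives

/-! ### Powers of the distance to the origin -/

section NormPowers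

set_option maxSynthPendingDepth 3

variable {E : Type*} [NormedAddCommGroup E] [InnerProductSpace ℝ E] {M : Set E} {x : E}

theorem hasFDerivAt_norm_rpow_of_ne_zero (hx : x ≠ 0) (k : ℝ) :
    HasFDerivAt (fun y : E => ‖y‖ ^ k) ((k * ‖x‖ ^ (k - 2)) • realInnerL x) x := by
  have h1 : HasFDerivAt (fun y : E => ‖y‖ ^ 2) (2 • realInnerL x) x :=
    (hasFDerivAt_id x).norm_sq
  have hx0 : 0 < ‖x‖ := norm_pos_iff.2 hx
  have h2 := h1.rpow_const (p := k / 2) (Or.inl (by positivity))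
  have hpow : ∀ (y : E) (a : ℝ), (‖y‖ ^ 2) ^ (a / 2) = ‖y‖ ^ a := fun y a => by
    rw [← Real.rpow_natCast_mul (norm_nonneg y)]
    congr 1
    push_cast
    ring
  simp only [hpow] at h2
  refine h2.congr_fderiv ?_
  have h3 : (‖x‖ ^ 2) ^ (k / 2 - 1) = ‖x‖ ^ (k - 2) := by
    rw [← hpow x (k - 2)]; congr 1; ring
  rw [h3]
  ext v
  simp
  ring

theorem hasFDerivAt_norm_rpow_smul (hx : x ≠ 0) (k : ℝ) :
    HasFDerivAt (fun y : E => ‖y‖ ^ k • y)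
      (‖x‖ ^ k • ContinuousLinearMap.id ℝ E +
        ((k * ‖x‖ ^ (k - 2)) • realInnerL x).smulRight x) x :=
  (hasFDerivAt_norm_rpow_of_ne_zero hx k).smul (hasFDerivAt_id x)

theorem hasFDerivAt_norm_inv_smul (hx : x ≠ 0) :
    HasFDerivAt (fun y : E => ‖y‖⁻¹ • y)
      (‖x‖⁻¹ • ContinuousLinearMap.id ℝ E - ((‖x‖⁻¹ ^ 3) • realInnerL x).smulRight x) x := by
  have h := hasFDerivAt_norm_rpow_smul hx (-1)
  simp only [Real.rpow_neg_one] at h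
  refine h.congr_fderiv ?_
  have h3 : ‖x‖ ^ ((-1 : ℝ) - 2) = ‖x‖⁻¹ ^ 3 := by
    rw [show (-1 : ℝ) - 2 = -((3 : ℕ) : ℝ) by norm_num, Real.rpow_neg (norm_nonneg x),
      Real.rpow_natCast, inv_pow]
  rw [h3]
  ext v
  simp
  module

theorem fderiv_norm_apply_of_ne_zero (hx : x ≠ 0) (v : E) :
    fderiv ℝ (fun y : E => ‖y‖) x v = ‖x‖⁻¹ * inner ℝ x v := by
  have h := hasFDerivAt_norm_rpow_of_ne_zero hx 1
  simp only [Real.rpow_one] at h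
  have h3 : ‖x‖ ^ ((1 : ℝ) - 2) = ‖x‖⁻¹ := by
    rw [← Real.rpow_neg_one]; norm_num
  rw [h.fderiv, h3]
  simp

variable [FiniteDimensional ℝ E] {V : E → E}

/-- The divergence of a combination of a field and of a power of the distance to the origin times
the position vector, at a point where the position vector is tangent to the submanifold. -/
theorem tangentialDivergence_smul_sub (hx : x ≠ 0) (hxT : x ∈ tangentSpaceAt M x)
    (hV : DifferentiableWithinAt ℝ V M x) (s c k : ℝ) :
    tangentialDivergence M (fun y => s • V y - (c * ‖y‖ ^ k) • y) x =
      s * tangentialDivergence M V x -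
        c * (Module.finrank ℝ (tangentSpaceAt M x) + k) * ‖x‖ ^ k := by
  set b := stdOrthonormalBasis ℝ (tangentSpaceAt M x)
  have h1 := (hV.hasFDerivWithinAt.const_smul s).sub
    ((hasFDerivAt_norm_rpow_smul hx k).hasFDerivWithinAt (s := M).const_smul c)
  have h2 : (fun y => s • V y - (c * ‖y‖ ^ k) • y) = s • V - c • fun y : E => ‖y‖ ^ k • y := by
    funext y
    simp [mul_smul]
  have hx0 : 0 < ‖x‖ := norm_pos_iff.2 hx
  have h3 : ∑ i, inner ℝ x (b i : E) ^ 2 = ‖x‖ ^ 2 := by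
    have := b.sum_sq_norm_inner_left ⟨x, hxT⟩
    simpa using this
  have h4 : ‖x‖ ^ (k - 2) * ‖x‖ ^ 2 = ‖x‖ ^ k := by
    rw [← Real.rpow_natCast ‖x‖ 2, ← Real.rpow_add hx0]
    congr 1
    push_cast
    ring
  have hb : ∀ i, ‖(b i : E)‖ = 1 := b.orthonormal.1
  rw [h2, tangentialDivergence_eq_sum h1 b, tangentialDivergence_eq_sum hV.hasFDerivWithinAt b,
    Finset.mul_sum]
  have hterm : ∀ i, inner ℝ ((s • fderivWithin ℝ V M x - c • (‖x‖ ^ k • ContinuousLinearMap.id ℝ E +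
        ((k * ‖x‖ ^ (k - 2)) • realInnerL x).smulRight x)) (b i : E))
        (b i : E) =
      s * inner ℝ (fderivWithin ℝ V M x (b i)) (b i : E) - c * ‖x‖ ^ k -
        c * (k * ‖x‖ ^ (k - 2)) * inner ℝ x (b i : E) ^ 2 := fun i => by
    simp [inner_sub_left, inner_add_left, inner_smul_left, hb]
    ring
  rw [Finset.sum_congr rfl fun i _ => hterm i, Finset.sum_sub_distrib, Finset.sum_sub_distrib,
    ← Finset.mul_sum, ← Finset.mul_sum, ← Finset.mul_sum, h3]
  simp
  linear_combination (-c * k) * h4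

end NormPowers

/-! ### Homogeneous harmonic fields on a cone -/

section Cone

set_option maxSynthPendingDepth 3

open Set Filter Topology Metric

variable {E : Type*} [NormedAddCommGroup E] [InnerProductSpace ℝ E] {S M : Set E} {n : ℕ} {x : E}

theorem smul_mem_coneOver (hx : x ∈ coneOver S) {t : ℝ} (ht : 0 < t) : t • x ∈ coneOver S := by
  obtain ⟨r, hr, σ, hσ, rfl⟩ := hx
  exact ⟨t * r, mul_pos ht hr, σ, hσ, smul_smul t r σ⟩

theorem subset_coneOver : S ⊆ coneOver S := fun σ hσ => ⟨1, one_pos, σ, hσ, (one_smul ℝ σ).symm⟩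

omit [InnerProductSpace ℝ E] in
theorem norm_eq_one_of_mem (hS : S ⊆ sphere 0 1) {σ : E} (hσ : σ ∈ S) : ‖σ‖ = 1 := by
  simpa using hS hσ

theorem norm_pos_of_mem_coneOver (hS : S ⊆ sphere 0 1) (hx : x ∈ coneOver S) : 0 < ‖x‖ := by
  obtain ⟨r, hr, σ, hσ, rfl⟩ := hx
  rw [norm_smul, norm_eq_one_of_mem hS hσ, mul_one]
  exact norm_pos_iff.2 hr.ne'

theorem ne_zero_of_mem_coneOver (hS : S ⊆ sphere 0 1) (hx : x ∈ coneOver S) : x ≠ 0 :=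
  norm_pos_iff.1 (norm_pos_of_mem_coneOver hS hx)

theorem norm_inv_smul_mem (hS : S ⊆ sphere 0 1) (hx : x ∈ coneOver S) : ‖x‖⁻¹ • x ∈ S := by
  obtain ⟨r, hr, σ, hσ, rfl⟩ := hx
  rw [norm_smul, norm_eq_one_of_mem hS hσ, mul_one, Real.norm_of_nonneg hr.le, smul_smul,
    inv_mul_cancel₀ hr.ne', one_smul]
  exact hσ

theorem mem_tangentSpaceAt_coneOver (hx : x ∈ coneOver S) :
    x ∈ tangentSpaceAt (coneOver S) x := by
  refine mem_tangentSpaceAt_of_hasDerivAt (γ := fun t : ℝ => (1 + t) • x) (by simp) ?_ ?_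
  · filter_upwards [lt_mem_nhds (show (-1 : ℝ) < 0 by norm_num)] with t ht
    exact smul_mem_coneOver hx (by linarith)
  · simpa using ((hasDerivAt_id (0 : ℝ)).const_add 1).smul_const x

theorem tangentSpaceAt_coneOver_le {t : ℝ} (ht : 0 < t) :
    tangentSpaceAt (coneOver S) x ≤ tangentSpaceAt (coneOver S) (t • x) := by
  refine Submodule.span_le.2 ?_
  rintro v ⟨γ, h0, hM, hγ⟩
  have h : t • v ∈ tangentSpaceAt (coneOver S) (t • x) :=
    mem_tangentSpaceAt_of_hasDerivAt (γ := fun s => t • γ s) (by rw [h0])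
      (hM.mono fun s hs => smul_mem_coneOver hs ht) (hγ.const_smul t)
  simpa [smul_smul, ht.ne'] using Submodule.smul_mem _ t⁻¹ h

/-- The tangent space of a cone is constant along the rays. -/
theorem tangentSpaceAt_coneOver_smul {t : ℝ} (ht : 0 < t) :
    tangentSpaceAt (coneOver S) (t • x) = tangentSpaceAt (coneOver S) x := by
  refine le_antisymm ?_ (tangentSpaceAt_coneOver_le ht)
  have h := tangentSpaceAt_coneOver_le (S := S) (x := t • x) (inv_pos.2 ht)
  rwa [smul_smul, inv_mul_cancel₀ ht.ne', one_smul] at h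

theorem HasTangentGradAt.eq_zero_of_eventually_eq {f : E → ℝ} {g : E} {c : ℝ}
    (h : HasTangentGradAt M f g x) (hx : x ∈ M) (hg : g ∈ tangentSpaceAt M x)
    (hf : ∀ᶠ y in 𝓝[M] x, f y = c) : g = 0 := by
  obtain ⟨L, hL, hLg⟩ := h
  have h0 : HasFDerivWithinAt f (0 : E →L[ℝ] ℝ) M x :=
    (hasFDerivWithinAt_const c x M).congr_of_eventuallyEq hf (hf.self_of_nhdsWithin hx)
  have := hL.eq_on_tangentSpaceAt h0 hg
  rw [hLg g hg] at this
  exact inner_self_eq_zero.1 this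

theorem HasTangentGradAt.const_mul {f : E → ℝ} {g : E} (h : HasTangentGradAt M f g x) (s : ℝ) :
    HasTangentGradAt M (fun y => s * f y) (s • g) x := by
  obtain ⟨L, hL, hg⟩ := h
  exact ⟨s • L, hL.const_mul s, fun v hv => by simp [hg v hv, inner_smul_left]⟩

variable {V : E → E} {lam : ℝ}

theorem inner_self_smul_of_homogeneous
    (hhom : ∀ x ∈ coneOver S, ∀ t : ℝ, 0 < t → V (t • x) = t ^ lam • V x) (hx : x ∈ coneOver S)
    {t : ℝ} (ht : 0 < t) :
    inner ℝ (V (t • x)) (t • x) = t ^ (lam + 1) * inner ℝ (V x) x := by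
  rw [hhom x hx t ht, inner_smul_left, inner_smul_right, Real.rpow_add ht, Real.rpow_one]
  simp
  ring

variable [FiniteDimensional ℝ E]

/-- A tangent vector field on `M` whose dual 1-form is closed and co-closed. -/
structure IsHarmonicField (M : Set E) (V : E → E) : Prop where
  mem_tangentSpaceAt : ∀ x ∈ M, V x ∈ tangentSpaceAt M x
  differentiableOn : DifferentiableOn ℝ V M
  fderivWithin_symm : ∀ x ∈ M, ∀ u ∈ tangentSpaceAt M x, ∀ v ∈ tangentSpaceAt M x,
    inner ℝ (fderivWithin ℝ V M x u) v = inner ℝ (fderivWithin ℝ V M x v) u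
  tangentialDivergence_eq_zero : ∀ x ∈ M, tangentialDivergence M V x = 0

/-- Cartan's formula for the Lie derivative along the Euler field: up to the factor `lam + 1`, a
closed field of homogeneity `lam` is the gradient of its contraction `⟪V y, y⟫` with the Euler
field. -/
theorem IsHarmonicField.hasTangentGradAt_inner_self (hV : IsHarmonicField (coneOver S) V)
    (hhom : ∀ x ∈ coneOver S, ∀ t : ℝ, 0 < t → V (t • x) = t ^ lam • V x) (hx : x ∈ coneOver S) :
    HasTangentGradAt (coneOver S) (fun y => inner ℝ (V y) y) ((lam + 1) • V x) x := by
  have hD := (hV.differentiableOn x hx).hasFDerivWithinAt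
  set D := fderivWithin ℝ V (coneOver S) x
  have hxT := mem_tangentSpaceAt_coneOver hx
  -- Euler's relation
  have hEuler : D x = lam • V x := by
    have hray : HasDerivAt (fun t : ℝ => t • x) x 1 := by
      simpa using (hasDerivAt_id (1 : ℝ)).smul_const x
    have hpos : ∀ᶠ t : ℝ in 𝓝 1, 0 < t := lt_mem_nhds one_pos
    have h1 : HasFDerivWithinAt V D (coneOver S) ((1 : ℝ) • x) := by rwa [one_smul]
    have h2 := h1.comp_hasDerivAt (f := fun t : ℝ => t • x) 1 hray
      (hpos.mono fun t ht => smul_mem_coneOver hx ht)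
    have h3 : HasDerivAt (fun t : ℝ => t ^ lam • V x) (lam • V x) 1 := by
      simpa using (Real.hasDerivAt_rpow_const (x := 1) (p := lam) (Or.inl one_ne_zero)).smul_const
        (V x)
    exact h2.unique (h3.congr_of_eventuallyEq (hpos.mono fun t ht => hhom x hx t ht))
  refine ⟨_, hD.inner ℝ (hasFDerivWithinAt_id x _), fun v hv => ?_⟩
  have h4 : inner ℝ (D v) x = lam * inner ℝ (V x) v := by
    rw [hV.fderivWithin_symm x hx v hv x hxT, hEuler, inner_smul_left]
    simp
  simp [h4, inner_smul_left]
  ring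

/-- The weak maximum principle for a function with gradient `s V - c r ^ k y`, where `V` is
harmonic, that is maximal at a point of the link: as `V` has no divergence, the sign of the
divergence `-c (n + k) r ^ k` is determined. -/
theorem coneOver_barrier (hC : IsEmbeddedSubmanifold n (coneOver S)) (hS : S ⊆ sphere 0 1)
    (hV : IsHarmonicField (coneOver S) V) {σ : E} (hσ : σ ∈ S) {f : E → ℝ} {s c k : ℝ}
    (hf : ∀ y ∈ coneOver S, HasTangentGradAt (coneOver S) f (s • V y - (c * ‖y‖ ^ k) • y) y)
    (hmax : ∀ y ∈ coneOver S, f y ≤ f σ) : 0 ≤ c * (n + k) := by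
  have hσC := subset_coneOver hσ
  have hσ0 := ne_zero_of_mem_coneOver hS hσC
  have hσT := mem_tangentSpaceAt_coneOver hσC
  have hdiff := hV.differentiableOn σ hσC
  have h := tangentialDivergence_nonpos_of_isMaxOn hC hσC hf
    (Submodule.sub_mem _ (Submodule.smul_mem _ _ (hV.mem_tangentSpaceAt σ hσC))
      (Submodule.smul_mem _ _ hσT)) ?_ hmax
  · rw [tangentialDivergence_smul_sub hσ0 hσT hdiff, hV.tangentialDivergence_eq_zero σ hσC,
      hC.finrank_tangentSpaceAt hσC, norm_eq_one_of_mem hS hσ, Real.one_rpow] at h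
    linarith
  · simp only [mul_smul]
    exact (hdiff.const_smul s).sub
      ((hasFDerivAt_norm_rpow_smul hσ0 k).differentiableAt.differentiableWithinAt.const_smul c)

/-- A harmonic field of homogeneity `lam` on an `n`-dimensional cone vanishes if `lam + 1` lies
strictly between the exponents `0` and `2 - n` of the radial harmonic functions. -/
theorem IsHarmonicField.eq_zero_of_exponent (hC : IsEmbeddedSubmanifold n (coneOver S))
    (hS : S ⊆ sphere 0 1) (hcomp : IsCompact S) (hV : IsHarmonicField (coneOver S) V)
    (hhom : ∀ x ∈ coneOver S, ∀ t : ℝ, 0 < t → V (t • x) = t ^ lam • V x)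
    (hlam : (lam + 1) * (n + (lam + 1) - 2) < 0) : ∀ x ∈ coneOver S, V x = 0 := by
  set F : E → ℝ := fun y => inner ℝ (V y) y with hF
  have hgrad : ∀ y ∈ coneOver S, HasTangentGradAt (coneOver S) F ((lam + 1) • V y) y :=
    fun y hy => hV.hasTangentGradAt_inner_self hhom hy
  have hcone : ∀ y ∈ coneOver S, F y = ‖y‖ ^ (lam + 1) * F (‖y‖⁻¹ • y) := fun y hy => by
    have hpos := norm_pos_of_mem_coneOver hS hy
    have h := inner_self_smul_of_homogeneous hhom (subset_coneOver (norm_inv_smul_mem hS hy)) hpos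
    rwa [smul_smul, mul_inv_cancel₀ hpos.ne', one_smul] at h
  have hFcont : ContinuousOn F S := fun σ hσ => by
    obtain ⟨L, hL, -⟩ := hgrad σ (subset_coneOver hσ)
    exact hL.continuousWithinAt.mono subset_coneOver
  -- `s * F - m * r ^ (lam + 1)` would violate the maximum principle if `m > 0`
  have hle : ∀ s : ℝ, ∀ σ ∈ S, s * F σ ≤ 0 := by
    intro s σ hσ
    obtain ⟨σ₀, hσ₀, hmax⟩ := hcomp.exists_isMaxOn ⟨σ, hσ⟩ (hFcont.const_mul s)
    rw [isMaxOn_iff] at hmax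
    refine (hmax σ hσ).trans ?_
    by_contra! hm
    set m := s * F σ₀ with hmdef
    have h := coneOver_barrier hC hS hV hσ₀ (f := fun y => s * F y - m * ‖y‖ ^ (lam + 1))
      (s := s * (lam + 1)) (c := m * (lam + 1)) (k := lam + 1 - 2) ?_ ?_
    · nlinarith
    · intro y hy
      have h1 : HasTangentGradAt (coneOver S) (fun y => ‖y‖ ^ (lam + 1))
          (((lam + 1) * ‖y‖ ^ (lam + 1 - 2)) • y) y :=
        ⟨_, (hasFDerivAt_norm_rpow_of_ne_zero (ne_zero_of_mem_coneOver hS hy) _).hasFDerivWithinAt,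
          fun v _ => by simp [inner_smul_left]⟩
      have h2 := ((hgrad y hy).const_mul s).sub (h1.const_mul m)
      simpa only [smul_smul, mul_assoc] using h2
    · intro y hy
      have h1 : s * F σ₀ - m * ‖σ₀‖ ^ (lam + 1) = 0 := by
        rw [norm_eq_one_of_mem hS hσ₀, Real.one_rpow, mul_one, sub_self]
      rw [h1, hcone y hy]
      have h2 := hmax _ (norm_inv_smul_mem hS hy)
      have h3 : 0 ≤ ‖y‖ ^ (lam + 1) := by positivity
      nlinarith
  have hF0 : ∀ y ∈ coneOver S, F y = 0 := fun y hy => by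
    have h1 := hle 1 _ (norm_inv_smul_mem hS hy)
    have h2 := hle (-1) _ (norm_inv_smul_mem hS hy)
    rw [hcone y hy, show F (‖y‖⁻¹ • y) = 0 by linarith, mul_zero]
  intro x hx
  have h := (hgrad x hx).eq_zero_of_eventually_eq hx
    (Submodule.smul_mem _ _ (hV.mem_tangentSpaceAt x hx))
    (eventually_of_mem self_mem_nhdsWithin hF0)
  refine (smul_eq_zero.1 h).resolve_left fun h0 => ?_
  rw [h0] at hlam
  simp at hlam

/-- On the cone over a simply connected link, a closed field of homogeneity `-1` whose radial
component is `e / r` is, up to its radial part, the gradient of a function of homogeneity `0`. -/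
theorem IsHarmonicField.exists_primitive (hC : IsEmbeddedSubmanifold n (coneOver S))
    (hS : S ⊆ sphere 0 1) [SimplyConnectedSpace S] [LocallyPathConnectedSpace S]
    (hV : IsHarmonicField (coneOver S) V)
    (hhom : ∀ x ∈ coneOver S, ∀ t : ℝ, 0 < t → V (t • x) = t ^ (-1 : ℝ) • V x) {e : ℝ}
    (he : ∀ x ∈ coneOver S, inner ℝ (V x) x = e) :
    ∃ G : E → ℝ, ∀ x ∈ coneOver S, HasTangentGradAt (coneOver S) (fun y => G (‖y‖⁻¹ • y))
      (V x - (e * ‖x‖ ^ (-2 : ℝ)) • x) x := by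
  have hloc : ∀ σ : S, ∃ f : E → ℝ, ∀ᶠ y in 𝓝[coneOver S] (σ : E),
      HasTangentGradAt (coneOver S) f (V y) y := fun σ =>
    hC.exists_hasTangentGradAt (subset_coneOver σ.2) hV.differentiableOn hV.fderivWithin_symm
  choose f hf using hloc
  obtain ⟨G, hG⟩ := exists_glue_of_sub_locallyConstant
    (fun σ : S => interior {z : S | ∀ᶠ y in 𝓝[coneOver S] (z : E),
      HasTangentGradAt (coneOver S) (f σ) (V y) y}) (fun σ z => f σ z)
    (fun σ => isOpen_interior)
    (fun σ => by
      rw [mem_interior_iff_mem_nhds]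
      have h := eventually_eventually_nhdsWithin.2 (hf σ)
      exact (eventually_nhds_subtype_iff S σ _).2
        (h.filter_mono (nhdsWithin_mono _ subset_coneOver)))
    (fun i j z hz => by
      have hi := interior_subset hz.1
      have hj := interior_subset hz.2
      have h : ∀ᶠ y in 𝓝[coneOver S] (z : E),
          HasTangentGradAt (coneOver S) (fun y => f i y - f j y) 0 y := by
        filter_upwards [hi, hj] with y hyi hyj
        simpa using hyi.sub hyj
      have h2 := hC.eventually_eq_of_hasTangentGradAt_zero (subset_coneOver z.2) h
      exact (eventually_nhds_subtype_iff S z (fun y => f i y - f j y = f i z - f j z)).2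
        (h2.filter_mono (nhdsWithin_mono _ subset_coneOver)))
  set G' : E → ℝ := Function.extend Subtype.val G 0
  have hG' : ∀ σ : S, G' σ = G σ := fun σ => Subtype.val_injective.extend_apply G 0 σ
  refine ⟨G', fun x hx => ?_⟩
  have hx0 := ne_zero_of_mem_coneOver hS hx
  have hxpos := norm_pos_of_mem_coneOver hS hx
  set σ : S := ⟨‖x‖⁻¹ • x, norm_inv_smul_mem hS hx⟩ with hσ
  have hπ := hasFDerivAt_norm_inv_smul hx0
  obtain ⟨L, hL, hLV⟩ := (hf σ).self_of_nhdsWithin (subset_coneOver σ.2)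
  have hmaps : MapsTo (fun y : E => ‖y‖⁻¹ • y) (coneOver S) (coneOver S) := fun y hy =>
    subset_coneOver (norm_inv_smul_mem hS hy)
  have htend : Tendsto (fun y : E => ‖y‖⁻¹ • y) (𝓝[coneOver S] x) (𝓝[S] (σ : E)) :=
    tendsto_nhdsWithin_iff.2 ⟨hπ.continuousAt.mono_left nhdsWithin_le_nhds,
      eventually_of_mem self_mem_nhdsWithin fun y hy => norm_inv_smul_mem hS hy⟩
  have hev : ∀ᶠ z in 𝓝[S] (σ : E), G' z = f σ z + (G' σ - f σ σ) := by
    refine (eventually_nhds_subtype_iff S σ _).1 ?_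
    filter_upwards [hG σ] with z hz
    rw [hG', hG']
    linarith
  have hcomp := (HasFDerivWithinAt.comp (f := fun y : E => ‖y‖⁻¹ • y) x hL
    hπ.hasFDerivWithinAt hmaps).add_const (G' σ - f σ σ)
  refine ⟨_, hcomp.congr_of_eventuallyEq (htend.eventually hev) (by simp [hσ]), fun v hv => ?_⟩
  have hTσ : tangentSpaceAt (coneOver S) (σ : E) = tangentSpaceAt (coneOver S) x :=
    tangentSpaceAt_coneOver_smul (inv_pos.2 hxpos)
  have hxT := mem_tangentSpaceAt_coneOver hx
  have hVσ : V σ = ‖x‖ • V x := by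
    rw [hσ, hhom x hx _ (inv_pos.2 hxpos), Real.rpow_neg_one, inv_inv]
  have hmem : ‖x‖⁻¹ • v - (‖x‖⁻¹ ^ 3 * inner ℝ x v) • x ∈ tangentSpaceAt (coneOver S) (σ : E) := by
    rw [hTσ]
    exact Submodule.sub_mem _ (Submodule.smul_mem _ _ hv) (Submodule.smul_mem _ _ hxT)
  have h1 := hLV _ hmem
  have h2 : ‖x‖ ^ (-2 : ℝ) = ‖x‖⁻¹ ^ 2 := by
    rw [show (-2 : ℝ) = -((2 : ℕ) : ℝ) by norm_num, Real.rpow_neg (norm_nonneg x),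
      Real.rpow_natCast, inv_pow]
  simp only [ContinuousLinearMap.comp_apply, sub_apply, smul_apply,
    ContinuousLinearMap.id_apply, ContinuousLinearMap.smulRight_apply, realInnerL_apply,
    smul_eq_mul]
  rw [h1, hVσ, inner_sub_right, inner_sub_left, inner_smul_right, inner_smul_right,
    inner_smul_left, inner_smul_left, inner_smul_left, he x hx, h2]
  simp only [conj_trivial]
  field_simp

/-- A harmonic field of homogeneity `-1` on a cone of dimension at least three with a simply
connected link vanishes. -/
theorem IsHarmonicField.eq_zero_of_simplyConnected (hC : IsEmbeddedSubmanifold n (coneOver S))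
    (hS : S ⊆ sphere 0 1) (hcompact : IsCompact S) (hn : 2 < n) [SimplyConnectedSpace S]
    [LocallyPathConnectedSpace S] (hV : IsHarmonicField (coneOver S) V)
    (hhom : ∀ x ∈ coneOver S, ∀ t : ℝ, 0 < t → V (t • x) = t ^ (-1 : ℝ) • V x) :
    ∀ x ∈ coneOver S, V x = 0 := by
  obtain ⟨σ₁⟩ : Nonempty S := inferInstance
  -- the radial component is a constant multiple of `1 / r`
  obtain ⟨e, he⟩ : ∃ e : ℝ, ∀ x ∈ coneOver S, inner ℝ (V x) x = e := by
    have hconst : IsLocallyConstant fun σ : S => (inner ℝ (V σ) (σ : E) : ℝ) := by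
      rw [IsLocallyConstant.iff_eventually_eq]
      intro σ
      have h := hC.eventually_eq_of_hasTangentGradAt_zero (subset_coneOver σ.2)
        (f := fun y => inner ℝ (V y) y)
        (eventually_of_mem self_mem_nhdsWithin fun y hy => by
          simpa using hV.hasTangentGradAt_inner_self hhom hy)
      exact (eventually_nhds_subtype_iff S σ (fun y => inner ℝ (V y) y = inner ℝ (V σ) (σ : E))).2
        (h.filter_mono (nhdsWithin_mono _ subset_coneOver))
    refine ⟨inner ℝ (V σ₁) (σ₁ : E), fun x hx => ?_⟩
    have hpos := norm_pos_of_mem_coneOver hS hx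
    have h := inner_self_smul_of_homogeneous hhom hx (inv_pos.2 hpos)
    rw [neg_add_cancel, Real.rpow_zero, one_mul] at h
    rw [← h]
    exact hconst.apply_eq_of_preconnectedSpace ⟨_, norm_inv_smul_mem hS hx⟩ σ₁
  obtain ⟨G, hG⟩ := hV.exists_primitive hC hS hhom he
  set H : E → ℝ := fun y => G (‖y‖⁻¹ • y) with hH
  have hHS : ∀ σ ∈ S, H σ = G σ := fun σ hσ => by simp [hH, norm_eq_one_of_mem hS hσ]
  have hHcone : ∀ y, H y = G (‖y‖⁻¹ • y) := fun y => rfl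
  have hcont : ContinuousOn G S := fun σ hσ => by
    obtain ⟨L, hL, -⟩ := hG σ (subset_coneOver hσ)
    exact (hL.continuousWithinAt.mono subset_coneOver).congr (fun y hy => (hHS y hy).symm)
      (hHS σ hσ).symm
  have hmax : ∀ s : ℝ, ∃ σ ∈ S, ∀ y ∈ coneOver S, s * H y ≤ s * H σ := fun s => by
    obtain ⟨σ, hσ, hmax⟩ := hcompact.exists_isMaxOn ⟨_, σ₁.2⟩ (hcont.const_mul s)
    refine ⟨σ, hσ, fun y hy => ?_⟩
    rw [hHS σ hσ]
    exact isMaxOn_iff.1 hmax _ (norm_inv_smul_mem hS hy)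
  -- comparing the divergences at a maximum and at a minimum, `e` vanishes
  have hse : ∀ s : ℝ, 0 ≤ s * e := fun s => by
    obtain ⟨σ, hσ, hσmax⟩ := hmax s
    have h := coneOver_barrier hC hS hV hσ (f := fun y => s * H y) (s := s) (c := s * e) (k := -2)
      (fun y hy => by
        have h1 := (hG y hy).const_mul s
        rwa [smul_sub, smul_smul, ← mul_assoc] at h1) hσmax
    have hn' : (2 : ℝ) < n := by exact_mod_cast hn
    exact nonneg_of_mul_nonneg_left h (by linarith)
  have he0 : e = 0 := by linarith [hse 1, hse (-1)]
  have hgrad : ∀ y ∈ coneOver S, HasTangentGradAt (coneOver S) H (V y) y := fun y hy => by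
    simpa [he0] using hG y hy
  -- by the strong maximum principle, the primitive is constant
  obtain ⟨σ₀, hσ₀, hσ₀max⟩ := hmax 1
  simp only [one_mul] at hσ₀max
  have hclopen : IsClopen {σ : S | H σ = H σ₀} := by
    constructor
    · refine isClosed_eq ?_ continuous_const
      refine (continuousOn_iff_continuous_domRestrict.1 hcont).congr fun σ => ?_
      exact (hHS σ σ.2).symm
    · rw [isOpen_iff_mem_nhds]
      intro σ hσ
      have hσ : H σ = H σ₀ := hσ
      have h := eventually_eq_of_isMaxOn_of_tangentialDivergence_eq_zero hC
        (subset_coneOver σ.2) hgrad hV.mem_tangentSpaceAt hV.differentiableOn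
        hV.tangentialDivergence_eq_zero (by rw [hσ]; exact hσ₀max)
      rw [hσ] at h
      exact (eventually_nhds_subtype_iff S σ (fun y => H y = H σ₀)).2
        (h.filter_mono (nhdsWithin_mono _ subset_coneOver))
  have huniv := hclopen.eq_univ ⟨⟨σ₀, hσ₀⟩, rfl⟩
  have hconst : ∀ y ∈ coneOver S, H y = H σ₀ := fun y hy => by
    have h : (⟨‖y‖⁻¹ • y, norm_inv_smul_mem hS hy⟩ : S) ∈ {σ : S | H σ = H σ₀} := by
      rw [huniv]; trivial
    rw [hHcone, ← hHS _ (norm_inv_smul_mem hS hy)]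
    exact h
  exact fun x hx => (hgrad x hx).eq_zero_of_eventually_eq hx (hV.mem_tangentSpaceAt x hx)
    (eventually_of_mem self_mem_nhdsWithin hconst)

end Cone

/-! ### From 1-forms to vector fields -/

section OneFormFields

set_option maxSynthPendingDepth 3

open Set Filter Topology Metric

variable {E : Type*} [NormedAddCommGroup E] [InnerProductSpace ℝ E] [FiniteDimensional ℝ E]
  {S M : Set E} {n : ℕ} {x : E}

namespace OneForm

variable {α : OneForm M}

theorem extend_apply_of_mem (hx : x ∈ M) {v : E} (hv : v ∈ tangentSpaceAt M x) :
    α.extend x v = α ⟨x, hx⟩ ⟨v, hv⟩ := by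
  rw [extend, dif_pos hx, ContinuousLinearMap.comp_apply]
  congr 1
  exact (tangentSpaceAt M x).orthogonalProjectionOnto_mem_subspace_eq_self ⟨v, hv⟩

theorem inner_sharp (v : E) : inner ℝ (α.sharp x) v = α.extend x v :=
  InnerProductSpace.toDual_symm_apply

theorem sharp_mem_tangentSpaceAt (hx : x ∈ M) : α.sharp x ∈ tangentSpaceAt M x := by
  rw [← Submodule.orthogonal_orthogonal (tangentSpaceAt M x), Submodule.mem_orthogonal']
  intro v hv
  rw [inner_sharp, extend, dif_pos hx, ContinuousLinearMap.comp_apply,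
    Submodule.orthogonalProjectionOnto_apply_of_mem_orthogonal hv, map_zero]

theorem eq_zero_of_sharp_eq_zero (h : ∀ x ∈ M, α.sharp x = 0) : α = 0 := by
  funext x
  ext v
  have h1 := extend_apply_of_mem (α := α) x.2 v.2
  rw [← inner_sharp, h x x.2, inner_zero_left] at h1
  simpa using h1.symm

theorem IsSmooth.differentiableOn (hα : α.IsSmooth) : DifferentiableOn ℝ α.extend M :=
  ContDiffOn.differentiableOn hα (by simp)

theorem IsSmooth.differentiableOn_sharp (hα : α.IsSmooth) : DifferentiableOn ℝ α.sharp M := by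
  have h : α.sharp = fun x => ∑ i, α.extend x (stdOrthonormalBasis ℝ E i) •
      stdOrthonormalBasis ℝ E i := by
    funext x
    rw [← (stdOrthonormalBasis ℝ E).sum_repr' (α.sharp x)]
    refine Finset.sum_congr rfl fun i _ => ?_
    rw [real_inner_comm, inner_sharp]
  rw [h]
  have := hα.differentiableOn
  fun_prop

/-- Closedness of a 1-form, in terms of the derivative of the dual field. -/
theorem IsClosed.fderivWithin_sharp_symm (hα : α.IsSmooth) (hclosed : α.IsClosed) (hx : x ∈ M)
    {u v : E} (hu : u ∈ tangentSpaceAt M x) (hv : v ∈ tangentSpaceAt M x) :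
    inner ℝ (fderivWithin ℝ α.sharp M x u) v = inner ℝ (fderivWithin ℝ α.sharp M x v) u := by
  set Ω : E → E [⋀^Fin 1]→L[ℝ] ℝ := fun y =>
    ContinuousAlternatingMap.ofSubsingleton ℝ E ℝ (0 : Fin 1) (α.extend y)
  have hΩ : DifferentiableWithinAt ℝ Ω M x :=
    (ContinuousAlternatingMap.ofSubsingletonLIE (𝕜 := ℝ) (E := E) (F := ℝ)
      (0 : Fin 1)).differentiable.differentiableAt.comp_differentiableWithinAt x
        (hα.differentiableOn x hx)
  have hkey : ∀ a ∈ tangentSpaceAt M x, ∀ b : E,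
      fderivWithin ℝ Ω M x a (fun _ => b) = inner ℝ (fderivWithin ℝ α.sharp M x a) b := by
    intro a ha b
    have h1 : HasFDerivWithinAt (fun y => Ω y fun _ => b)
        ((ContinuousAlternatingMap.apply ℝ E ℝ fun _ : Fin 1 => b).comp (fderivWithin ℝ Ω M x))
        M x := (ContinuousAlternatingMap.apply ℝ E ℝ
          fun _ : Fin 1 => b).hasFDerivAt.comp_hasFDerivWithinAt x hΩ.hasFDerivWithinAt
    have h2 : HasFDerivWithinAt (fun y => Ω y fun _ => b)
        ((realInnerL b).comp (fderivWithin ℝ α.sharp M x)) M x := by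
      have h3 := (realInnerL b).hasFDerivAt.comp_hasFDerivWithinAt x
        (hα.differentiableOn_sharp x hx).hasFDerivWithinAt
      refine h3.congr (fun y _ => ?_) ?_
      all_goals
        rw [Function.comp_apply, realInnerL_apply, real_inner_comm, inner_sharp]
        simp [Ω]
    have := h1.eq_on_tangentSpaceAt h2 ha
    simpa [real_inner_comm] using this
  have h := congrArg (fun A => A ![⟨u, hu⟩, ⟨v, hv⟩]) (hclosed ⟨x, hx⟩)
  have h' : ContinuousAlternatingMap.alternatizeUncurryFin (fderivWithin ℝ Ω M x) ![u, v] = 0 := by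
    refine Eq.trans ?_ h
    exact congrArg _ (by ext i; fin_cases i <;> rfl)
  have hu' : (Fin.removeNth 1 ![u, v] : Fin 1 → E) = fun _ => u := by
    ext i; fin_cases i; rfl
  have hv' : (Fin.removeNth 0 ![u, v] : Fin 1 → E) = fun _ => v := by
    ext i; fin_cases i; rfl
  rw [ContinuousAlternatingMap.alternatizeUncurryFin_apply, Fin.sum_univ_two, hu', hv'] at h'
  simp only [Matrix.cons_val_zero, Matrix.cons_val_one, hkey u hu, hkey v hv] at h'
  simpa [add_neg_eq_zero] using h'

theorem isHarmonicField_sharp (hα : α.IsSmooth) (hclosed : α.IsClosed) (hco : α.IsCoclosed) :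
    IsHarmonicField M α.sharp where
  mem_tangentSpaceAt _ hx := sharp_mem_tangentSpaceAt hx
  differentiableOn := hα.differentiableOn_sharp
  fderivWithin_symm _ hx _ hu _ hv := hclosed.fderivWithin_sharp_symm hα hx hu hv
  tangentialDivergence_eq_zero x hx := neg_eq_zero.1 (hco ⟨x, hx⟩)

/-- The field dual to a 1-form of homogeneity `lam` scales by `t ^ lam` along the rays. -/
theorem IsHomogeneous.sharp_smul (hS : S ⊆ sphere 0 1) {α : OneForm (coneOver S)} {lam : ℝ}
    (hα : α.IsHomogeneous lam) (hx : x ∈ coneOver S) {t : ℝ} (ht : 0 < t) :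
    α.sharp (t • x) = t ^ lam • α.sharp x := by
  obtain ⟨η, β, hηβ⟩ := hα
  have hray : ∀ σ (hσ : σ ∈ S), ∀ r : ℝ, 0 < r → ∀ v ∈ tangentSpaceAt (coneOver S) σ,
      α.extend (r • σ) v =
        r ^ lam * (η ⟨σ, hσ⟩ * inner ℝ σ v + β.extend σ (v - (inner ℝ σ v : ℝ) • σ)) := by
    intro σ hσ r hr v hv
    have hrσ : r • σ ∈ coneOver S := ⟨r, hr, σ, hσ, rfl⟩
    have hv' : v ∈ tangentSpaceAt (coneOver S) (r • σ) := by rwa [tangentSpaceAt_coneOver_smul hr]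
    have hne := ne_zero_of_mem_coneOver hS hrσ
    have hnorm : ‖r • σ‖ = r := by
      rw [norm_smul, norm_eq_one_of_mem hS hσ, mul_one, Real.norm_of_nonneg hr.le]
    have h := hηβ ⟨σ, hσ⟩ r hr ⟨v, hv'⟩
    have hproj : fderiv ℝ (fun y : E => ‖y‖⁻¹ • y) (r • σ) v =
        r⁻¹ • (v - (inner ℝ σ v : ℝ) • σ) := by
      rw [(hasFDerivAt_norm_inv_smul hne).fderiv, hnorm]
      simp only [sub_apply, smul_apply, ContinuousLinearMap.id_apply,
        ContinuousLinearMap.smulRight_apply, realInnerL_apply, inner_smul_left, smul_eq_mul,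
        conj_trivial, smul_smul, smul_sub]
      congr 2
      field_simp
    simp only [hproj, fderiv_norm_apply_of_ne_zero hne, hnorm, map_smul, smul_eq_mul,
      inner_smul_left, conj_trivial] at h
    rw [extend_apply_of_mem hrσ hv', h, Real.rpow_add hr, Real.rpow_one]
    field_simp
  obtain ⟨r, hr, σ, hσ, rfl⟩ := hx
  have htr : 0 < t * r := mul_pos ht hr
  have hT := tangentSpaceAt_coneOver_smul (S := S) (x := σ) hr
  have hT' := tangentSpaceAt_coneOver_smul (S := S) (x := σ) htr
  have hmem1 := sharp_mem_tangentSpaceAt (α := α) ⟨r, hr, σ, hσ, rfl⟩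
  have hmem2 := sharp_mem_tangentSpaceAt (α := α) ⟨t * r, htr, σ, hσ, rfl⟩
  rw [hT] at hmem1
  rw [hT'] at hmem2
  rw [smul_smul]
  set w := α.sharp ((t * r) • σ) - t ^ lam • α.sharp (r • σ) with hw
  have hwT : w ∈ tangentSpaceAt (coneOver S) σ :=
    Submodule.sub_mem _ hmem2 (Submodule.smul_mem _ _ hmem1)
  have hw0 : inner ℝ w w = (0 : ℝ) := by
    nth_rewrite 1 [hw]
    rw [inner_sub_left, inner_smul_left, inner_sharp, inner_sharp, hray σ hσ _ htr w hwT,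
      hray σ hσ _ hr w hwT, Real.mul_rpow ht.le hr.le]
    simp only [conj_trivial]
    ring
  exact sub_eq_zero.1 (inner_self_eq_zero.1 hw0)

end OneForm

end OneFormFields

theorem mainTheorem7 (n : ℕ) (S : Set (EuclideanSpace ℂ (Fin n)))
    (hS_sphere : S ⊆ Metric.sphere 0 1) (hS_compact : IsCompact S)
    (hS_smooth : IsEmbeddedSubmanifold (n - 1) S)
    (θ : ℝ) (hC : IsSpecialLagrangian θ (coneOver S)) :
    (n = 4 → SimplyConnectedSpace S →
      ∀ α : OneForm (coneOver S), α.IsSmooth → α.IsHomogeneous (-1) →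
        α.IsClosed → α.IsCoclosed → α = 0) ∧
    (4 < n →
      ∀ α : OneForm (coneOver S), α.IsSmooth → α.IsHomogeneous ((2 - (n : ℝ)) / 2) →
        α.IsClosed → α.IsCoclosed → α = 0) := by
  constructor
  · intro hn hsc α hα hhom hclosed hco
    have := hS_smooth.locallyPathConnectedSpace
    exact α.eq_zero_of_sharp_eq_zero <|
      (OneForm.isHarmonicField_sharp hα hclosed hco).eq_zero_of_simplyConnected hC.1 hS_sphere
        hS_compact (by omega) fun x hx t ht => hhom.sharp_smul hS_sphere hx ht
  · intro hn α hα hhom hclosed hco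
    have hn' : (4 : ℝ) < n := by exact_mod_cast hn
    exact α.eq_zero_of_sharp_eq_zero <|
      (OneForm.isHarmonicField_sharp hα hclosed hco).eq_zero_of_exponent hC.1 hS_sphere
        hS_compact (fun x hx t ht => hhom.sharp_smul hS_sphere hx ht) (by nlinarith)
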